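/- An oriented graph is a digraph without loops, parallel arcs or digons (pairs of opposite arcs); it is $r$-regular if every vertex has exactly $r$ in-arcs and $r$ out-arcs. A set of vertices is acyclic if it induces no directed cycle, and $\vec\alpha(D)$ denotes the maximum size of an acyclic set of $D$. Given a total order $\preceq$ on $V(D)$, the greedy acyclic set of $D$ is obtained as follows: start with $A=\emptyset$ and $W=V(D)$; while $W\neq\emptyset$, let $w$ be the $\preceq$-smallest vertex of $W$, move $w$ from $W$ into $A$, and remove all out-neighbours of $w$ from $W$; output $A$. Let $\vec\alpha(D,\preceq)$ be its size. Events $E_1,E_2,\dots$ hold with very high probability (wvhp) if there is $c>0$ such that $\mathbb P(E_n)\ge 1-e^{-cn}$ for all sufficiently large $n$. Theorem. Let $r\ge 1$ be a fixed integer, let $\preceq$ be any total order on $[n]=\{1,\dots,n\}$, and let $D$ be chosen uniformly at random among all $r$-regular oriented graphs on $[n]$ (as $n\to\infty$). (1) $\vec\alpha(D,\preceq)\ge \frac15\,\frac{n\log_2(r+1)}{r}$ wvhp. (2) For every $\varepsilon>0$ there is $r_\varepsilon$ such that, if $r\ge r_\varepsilon$, then $\vec\alpha(D,\preceq)\ge\left(\frac12-\varepsilon\right)\frac{n\ln(r+1)}{r}$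 wvhp. In (1) and (2) the constant $c$ and the threshold for $n$ do not depend on $\preceq$. (3) There are absolute constants $a,b>0$ such that, for every $r\ge2$, $a\,\frac{n\ln r}{r}\le\vec\alpha(D)\le b\,\frac{n\ln r}{r}$ wvhp. -/

import Mathlib

open Filter

namespace RandDigraph

/-- `D` is an oriented graph: no loops and no digons. (A `Digraph` has no parallel arcs.) -/
def IsOriented {V : Type*} (D : Digraph V) : Prop :=
  (∀ v, ¬ D.Adj v v) ∧ ∀ v w, D.Adj v w → ¬ D.Adj w v

/-- Every vertex has exactly `r` out-arcs and exactly `r` in-arcs. -/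
def IsRegular {V : Type*} (r : ℕ) (D : Digraph V) : Prop :=
  ∀ v, {w | D.Adj v w}.ncard = r ∧ {w | D.Adj w v}.ncard = r

/-- `S` is acyclic: the subdigraph induced on `S` has no directed cycle, that is, no vertex can be
reached from itself by a directed walk of positive length inside `S`. -/
def IsAcyclicSet {V : Type*} (D : Digraph V) (S : Finset V) : Prop :=
  ∀ v, ¬ Relation.TransGen (fun a b => a ∈ S ∧ b ∈ S ∧ D.Adj a b) v v

open Classical in
/-- The maximum size of an acyclic set. -/
noncomputable def acyclicNumber {V : Type*} [Fintype V] (D : Digraph V) : ℕ :=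
  ((Finset.univ : Finset (Finset V)).filter (IsAcyclicSet D)).sup Finset.card

open Classical in
/-- The vertices that the greedy algorithm, run with respect to the total order `ord`, adds to its
output from the moment when its set of still available vertices is `W`: while `W` is non-empty,
the first vertex `w` of `W` is moved to the output, and the out-neighbours of `w` in `W` are
discarded. -/
noncomputable def greedyFrom {V : Type*} (ord : LinearOrder V) (D : Digraph V) (W : Finset V) :
    Finset V :=
  if h : W.Nonempty then
    insert (@Finset.min' V ord W h)
      (greedyFrom ord D
        (W.filter fun v => v ≠ @Finset.min' V ord W h ∧ ¬ D.Adj (@Finset.min' V ord W h) v))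
  else ∅
termination_by W.card
decreasing_by
  refine Finset.card_lt_card (Finset.filter_ssubset.2 ⟨@Finset.min' V ord W h, ?_, ?_⟩)
  · exact @Finset.min'_mem V ord W h
  · simp

/-- The greedy acyclic set of `D` with respect to the total order `ord`. -/
noncomputable def greedyAcyclicSet {V : Type*} [Fintype V] (ord : LinearOrder V) (D : Digraph V) :
    Finset V :=
  greedyFrom ord D Finset.univ

open Classical in
/-- The set of all `r`-regular oriented graphs on the vertex set `Fin n`. -/
noncomputable def regularOriented (n r : ℕ) : Finset (Digraph (Fin n)) :=
  Finset.univ.filter fun D => IsOriented D ∧ IsRegular r D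

open Classical in
/-- The probability that a uniformly random `r`-regular oriented graph on `Fin n` satisfies `P`.
(It is `0` when there is no such graph, so a positive lower bound on it includes existence.) -/
noncomputable def prob (n r : ℕ) (P : Digraph (Fin n) → Prop) : ℝ :=
  (((regularOriented n r).filter P).card : ℝ) / ((regularOriented n r).card : ℝ)

end RandDigraph

/-! Both bounds are first moment estimates. A greedy acyclic set out-dominates the digraph: every
vertex left out was discarded because of a chosen in-neighbour. So, for all orders at once, it
suffices that no set of fewer than αn vertices dominates, where α is of order log r / r. For the
upper bound, an acyclic set of size at least 2t, read in topological order, contains t-sets A and B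
with no arc from B to A, and for t of order n log r / r such pairs are unlikely.

Probabilities are computed in the configuration model, a uniform permutation taking out-points to
in-points in V × Fin r. The in-points hit from a fixed vertex set B form a uniform set of given
size. Its probabilities are at most nr + 1 times those of a binomial set of density |B|/n
(`card_perm_slice_le`), whose parts over different vertices are independent. This yields product
bounds that beat the number of sets in a union bound.

Passing to regular oriented graphs costs a polynomial factor only. Each graph arises from the same
number of conflict-free configurations (`natCard_fibre`), and switchings show that these are at
least a polynomial fraction of all configurations (`card_perm_le_conflictFree`). Exponentially small
failure probabilities survive this (`withVeryHighProb_of_config`). -/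

namespace RandDigraph

/-! ### Switchings of permutations -/

open Finset Equiv

/-- One step of the switching method: permutations with exactly `m` bad points are rare compared
with those having fewer bad points. -/
theorem switching_step {X : Type*} [Fintype X] [DecidableEq X] (Q : Perm X → Prop)
    (Bad : Perm X → X → Prop) [DecidablePred Q] [∀ σ, DecidablePred (Bad σ)] (C : ℕ)
    (ha : ∀ σ, Q σ → ∀ p, #{q | Bad (σ * swap p q) p} ≤ C)
    (hb : ∀ σ, Q σ → ∀ p, #{q | Bad (σ * swap p q) q ∨ ¬ Q (σ * swap p q)} ≤ C)
    (hc : ∀ σ p q x, Q σ → ¬ Bad (σ * swap p q) p → ¬ Bad (σ * swap p q) q →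
      Bad (σ * swap p q) x → Bad σ x) (m : ℕ) :
    (m + 1) * (Fintype.card X - 2 * C) * #{σ | Q σ ∧ #{x | Bad σ x} = m + 1} ≤
      Fintype.card X * C * #{σ | Q σ ∧ #{x | Bad σ x} ≤ m} := by
  set S : Finset (Perm X) := {σ | Q σ ∧ #{x | Bad σ x} = m + 1} with hS
  set T : Finset (Perm X) := {σ | Q σ ∧ #{x | Bad σ x} ≤ m} with hT
  -- Double counting of switchings: U holds the swaps that repair a bad p, leave q good and stay
  -- within Q; R holds candidates for their reversals, seen from the resulting permutation.
  let U : Finset (Σ _ : Perm X, Σ _ : X, X) :=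
    S.sigma fun σ => ({p | Bad σ p} : Finset X).sigma fun p =>
      {q | ¬ (Bad (σ * swap p q) p ∨ (Bad (σ * swap p q) q ∨ ¬ Q (σ * swap p q)))}
  let R : Finset (Σ _ : Perm X, Σ _ : X, X) :=
    T.sigma fun σ => (univ : Finset X).sigma fun p => {q | Bad (σ * swap p q) p}
  have hU : (m + 1) * (Fintype.card X - 2 * C) * #S ≤ #U := by
    rw [card_sigma, mul_comm]
    refine card_nsmul_le_sum _ _ _ fun σ hσ => ?_
    simp only [hS, mem_filter, mem_univ, true_and] at hσ
    rw [card_sigma, ← hσ.2]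
    refine card_nsmul_le_sum _ _ _ fun p _ => ?_
    have h1 := card_filter_add_card_filter_not (s := (univ : Finset X))
      (fun q => Bad (σ * swap p q) p ∨ (Bad (σ * swap p q) q ∨ ¬ Q (σ * swap p q)))
    have h2 := (card_union_le _ _).trans (add_le_add (ha σ hσ.1 p) (hb σ hσ.1 p))
    rw [← filter_or] at h2
    rw [card_univ] at h1
    omega
  have hR : #R ≤ Fintype.card X * C * #T := by
    rw [card_sigma, mul_comm]
    refine sum_le_card_nsmul _ _ _ fun σ hσ => ?_
    simp only [hT, mem_filter, mem_univ, true_and] at hσ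
    rw [card_sigma, ← card_univ]
    exact sum_le_card_nsmul _ _ _ fun p _ => ha σ hσ.1 p
  refine hU.trans (le_trans ?_ hR)
  refine card_le_card_of_injOn (fun a => ⟨a.1 * swap a.2.1 a.2.2, a.2⟩) ?_ ?_
  · rintro ⟨σ, p, q⟩ h
    simp only [U, hS, coe_sigma, Set.mem_sigma_iff, mem_coe, mem_filter, mem_univ, true_and,
      not_or, not_not] at h
    obtain ⟨⟨hQ, hm⟩, hp, h1, h2, h3⟩ := h
    simp only [R, hT, coe_sigma, Set.mem_sigma_iff, mem_coe, mem_filter, mem_univ, true_and,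
      mul_assoc, swap_mul_self, mul_one, hp, h3, and_true]
    -- By `hc` no point becomes bad, while p ceases to be bad.
    refine Nat.lt_succ_iff.1 (lt_of_lt_of_eq (card_lt_card ?_) hm)
    refine (ssubset_iff_of_subset fun x hx => ?_).2 ⟨p, by simpa using hp, by simpa using h1⟩
    simp only [mem_filter, mem_univ, true_and] at hx ⊢
    exact hc σ p q x hQ h1 h2 hx
  · rintro ⟨σ, p, q⟩ _ ⟨σ', p', q'⟩ _ h
    simp only [Sigma.mk.injEq, heq_eq_eq] at h
    obtain ⟨h1, rfl, h3⟩ := h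
    obtain rfl := by simpa using h3
    simpa using h1

/-- The switching method: a polynomial fraction of the permutations satisfying `Q` has no bad
point. -/
theorem switching_bound {X : Type*} [Fintype X] [DecidableEq X] (Q : Perm X → Prop)
    (Bad : Perm X → X → Prop) [DecidablePred Q] [∀ σ, DecidablePred (Bad σ)] (C : ℕ) (hC : 4 * C ≤ Fintype.card X)
    (ha : ∀ σ, Q σ → ∀ p, #{q | Bad (σ * swap p q) p} ≤ C)
    (hb : ∀ σ, Q σ → ∀ p, #{q | Bad (σ * swap p q) q ∨ ¬ Q (σ * swap p q)} ≤ C)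
    (hc : ∀ σ p q x, Q σ → ¬ Bad (σ * swap p q) p → ¬ Bad (σ * swap p q) q →
      Bad (σ * swap p q) x → Bad σ x) :
    #{σ | Q σ} ≤ (Fintype.card X + 1) ^ (2 * C) * #{σ | Q σ ∧ ∀ x, ¬ Bad σ x} := by
  have key : ∀ m ≤ Fintype.card X, #{σ | Q σ ∧ #{x | Bad σ x} ≤ m} ≤
      (m + 1) ^ (2 * C) * #{σ | Q σ ∧ #{x | Bad σ x} ≤ 0} := by
    intro m
    induction m with
    | zero => simp
    | succ m ih =>
      intro hm
      have h0 := ih (by omega)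
      have h1 := switching_step Q Bad C ha hb hc m
      clear ih
      obtain ⟨N, hN⟩ : ∃ N, N = Fintype.card X := ⟨_, rfl⟩
      rw [← hN] at h1 hm hC
      have h2 : #{σ | Q σ ∧ #{x | Bad σ x} ≤ m + 1} ≤
          #{σ | Q σ ∧ #{x | Bad σ x} ≤ m} + #{σ | Q σ ∧ #{x | Bad σ x} = m + 1} := by
        refine le_trans (card_le_card fun σ h => ?_) (card_union_le _ _)
        simp only [mem_union, mem_filter, mem_univ, true_and] at h ⊢
        rcases Nat.le_succ_iff.1 h.2 with h' | h'
        · exact Or.inl ⟨h.1, h'⟩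
        · exact Or.inr ⟨h.1, h'⟩
      set a := #{σ | Q σ ∧ #{x | Bad σ x} ≤ m}
      set b := #{σ | Q σ ∧ #{x | Bad σ x} = m + 1}
      set z := #{σ | Q σ ∧ #{x | Bad σ x} ≤ 0}
      -- As 4C ≤ N, the quotient N / (N - 2C) is at most 2.
      have h3 : (m + 1) * b ≤ 2 * C * a := by
        have : N ≤ 2 * (N - 2 * C) := by omega
        refine le_of_mul_le_mul_left (a := N) ?_ (by omega)
        calc N * ((m + 1) * b) ≤ 2 * (N - 2 * C) * ((m + 1) * b) := Nat.mul_le_mul_right _ this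
          _ = 2 * ((m + 1) * (N - 2 * C) * b) := by ring
          _ ≤ 2 * (N * C * a) := by omega
          _ = _ := by ring
      -- Bernoulli: 1 + 2C/(m+1) ≤ ((m+2)/(m+1))^(2C), so the successive ratios telescope to a
      -- polynomial.
      have h4 : ((m : ℝ) + 1 + 2 * C) * (m + 1) ^ (2 * C) ≤ (m + 1) * (m + 2) ^ (2 * C) := by
        have hm0 : (0 : ℝ) < m + 1 := by positivity
        have := one_add_mul_le_pow (a := 1 / ((m : ℝ) + 1))
          (le_trans (by norm_num) (by positivity : (0 : ℝ) ≤ _)) (2 * C)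
        have e : (1 + 1 / ((m : ℝ) + 1)) = (m + 2) / (m + 1) := by field_simp; ring
        rw [e, div_pow, le_div_iff₀ (by positivity)] at this
        have h5 := mul_le_mul_of_nonneg_left this hm0.le
        calc _ = ((m : ℝ) + 1) * ((1 + (2 * C : ℕ) * (1 / ((m : ℝ) + 1))) * (m + 1) ^ (2 * C)) := by
              push_cast; field_simp
          _ ≤ _ := h5
      have h4' : (m + 1 + 2 * C) * (m + 1) ^ (2 * C) ≤ (m + 1) * (m + 2) ^ (2 * C) := by
        exact_mod_cast h4
      refine le_of_mul_le_mul_left (a := m + 1) ?_ (by omega)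
      calc (m + 1) * _ ≤ (m + 1) * (a + b) := Nat.mul_le_mul_left _ h2
        _ ≤ (m + 1 + 2 * C) * a := by linarith
        _ ≤ (m + 1 + 2 * C) * ((m + 1) ^ (2 * C) * z) := Nat.mul_le_mul_left _ h0
        _ = (m + 1 + 2 * C) * (m + 1) ^ (2 * C) * z := by ring
        _ ≤ (m + 1) * (m + 2) ^ (2 * C) * z := Nat.mul_le_mul_right _ h4'
        _ = _ := by ring
  have h := key _ le_rfl
  have e1 : ({σ | Q σ ∧ #{x | Bad σ x} ≤ Fintype.card X} : Finset (Perm X)) =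
      ({σ | Q σ} : Finset (Perm X)) :=
    filter_congr fun σ _ => and_iff_left (card_le_univ _)
  have e2 : ({σ | Q σ ∧ #{x | Bad σ x} ≤ 0} : Finset (Perm X)) =
      ({σ | Q σ ∧ ∀ x, ¬ Bad σ x} : Finset (Perm X)) := by
    refine filter_congr fun σ _ => ?_
    simp [filter_eq_empty_iff]
  rwa [e1, e2] at h

/-! ### Conflict-free configurations are a polynomial fraction of all -/

/-- In the configuration `σ`, which joins the out-point `x` to the in-point `σ x`, the arcs at `x`
and `y` form a pair of parallel arcs, a digon, or (for `x = y`) a loop. -/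
def Conflict {V I : Type*} (σ : Perm (V × I)) (x y : V × I) : Prop :=
  (x ≠ y ∧ x.1 = y.1 ∧ (σ x).1 = (σ y).1) ∨ ((σ x).1 = y.1 ∧ (σ y).1 = x.1)

section Points

variable {V : Type*} [Fintype V] [DecidableEq V] {r : ℕ}

theorem card_fst_eq (v : V) : #{x : V × Fin r | x.1 = v} = r := by
  have : ({x : V × Fin r | x.1 = v} : Finset _) = {v} ×ˢ univ := by
    ext ⟨a, b⟩; simp [eq_comm]
  simp [this]

theorem card_perm_fst_eq (σ : Perm (V × Fin r)) (v : V) :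
    #{x : V × Fin r | (σ x).1 = v} = r := by
  refine Eq.trans ?_ (card_fst_eq (r := r) v)
  exact card_bij (fun x _ => σ x) (by simp) (fun _ _ _ _ h => σ.injective h)
    fun y hy => ⟨σ.symm y, by simpa using hy⟩

instance {I : Type*} [DecidableEq I] (σ : Perm (V × I)) (x y : V × I) :
    Decidable (Conflict σ x y) := by
  unfold Conflict; infer_instance

theorem card_exists_le {X Y : Type*} [Fintype X] [Fintype Y] [DecidableEq X]
    (P : Y → Prop) (R : Y → X → Prop) [DecidablePred P] [∀ y, DecidablePred (R y)] {a b : ℕ}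
    (hP : #{y | P y} ≤ a) (hR : ∀ y, #{x | R y x} ≤ b) [DecidablePred fun x => ∃ y, P y ∧ R y x] :
    #{x | ∃ y, P y ∧ R y x} ≤ a * b := by
  refine le_trans (card_le_card fun x hx => ?_) ((card_biUnion_le_card_mul
    ({y | P y} : Finset Y) (fun y => ({x | R y x} : Finset X)) b fun y _ => hR y).trans
      (Nat.mul_le_mul_right b hP))
  simpa using hx

theorem card_le_loopless (hr : 4 * r ≤ Fintype.card V * r) :
    Fintype.card (Perm (V × Fin r)) ≤ (Fintype.card V * r + 1) ^ (2 * r) *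
      #{σ : Perm (V × Fin r) | ∀ x, (σ x).1 ≠ x.1} := by
  have h := switching_bound (X := V × Fin r) (fun _ => True) (fun σ x => (σ x).1 = x.1) r
    (by simpa using hr) (fun σ _ p => ?_) (fun σ _ p => ?_) (fun σ p q x _ h1 h2 h3 => ?_)
  · simpa using h
  · simpa using (card_perm_fst_eq σ p.1).le
  · simpa [eq_comm] using (card_fst_eq (r := r) (σ p).1).le
  · have hp : x ≠ p := by rintro rfl; exact h1 h3
    have hq : x ≠ q := by rintro rfl; exact h2 h3
    rwa [Perm.mul_apply, swap_apply_of_ne_of_ne hp hq] at h3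

/-- Loops are removed beforehand because swapping the images of two loops at different vertices
creates a digon: a configuration with many loops would have too many harmful swaps at one point. -/
theorem card_loopless_le (hr : 4 * (2 * r ^ 2 + 4 * r) ≤ Fintype.card V * r) :
    #{σ : Perm (V × Fin r) | ∀ x, (σ x).1 ≠ x.1} ≤
      (Fintype.card V * r + 1) ^ (2 * (2 * r ^ 2 + 4 * r)) *
      #{σ : Perm (V × Fin r) | ∀ x y, ¬ Conflict σ x y} := by
  -- A harmful q lies over, or is sent over, a fixed vertex (at most r choices), or is reached
  -- through an intermediate point y (at most r * r choices).
  have bound : ∀ (A B D E F : V × Fin r → Prop) [DecidablePred A] [DecidablePred B]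
      [DecidablePred D] [DecidablePred E] [DecidablePred F], #{q | A q} ≤ r → #{q | B q} ≤ r →
      #{q | D q} ≤ r * r → #{q | E q} ≤ r * r → #{q | F q} ≤ r →
      ∀ (P : V × Fin r → Prop) [DecidablePred P], (∀ q, P q → A q ∨ B q ∨ D q ∨ E q ∨ F q) →
      #{q | P q} ≤ 2 * r ^ 2 + 4 * r := by
    intro A B D E F _ _ _ _ _ hA hB hD hE hF P _ h
    have : ({q | P q} : Finset (V × Fin r)) ⊆
        ({q | A q ∨ B q ∨ D q ∨ E q ∨ F q} : Finset (V × Fin r)) := by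
      intro q hq
      simpa using h q (by simpa using hq)
    refine (card_le_card this).trans ?_
    simp only [filter_or]
    have h1 := card_union_le (filter A univ)
      (filter B univ ∪ (filter D univ ∪ (filter E univ ∪ filter F univ)))
    have h2 := card_union_le (filter B univ) (filter D univ ∪ (filter E univ ∪ filter F univ))
    have h3 := card_union_le (filter D univ) (filter E univ ∪ filter F univ)
    have h4 := card_union_le (filter E univ) (filter F univ)
    nlinarith
  have hs (σ : Perm (V × Fin r)) (v) := (card_perm_fst_eq σ v).le
  have ht (v : V) := (card_fst_eq (r := r) v).le
  have ht' (v : V) : #{q : V × Fin r | v = q.1} ≤ r := by simpa [eq_comm] using ht v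
  have h := switching_bound (X := V × Fin r) (fun σ => ∀ x, (σ x).1 ≠ x.1)
    (fun σ x => ∃ y, Conflict σ x y) (2 * r ^ 2 + 4 * r)
    (by simpa using hr) (fun σ hσ p => ?_) (fun σ hσ p => ?_) (fun σ p q x hσ h1 h2 h3 => ?_)
  · simp only [Fintype.card_prod, Fintype.card_fin] at h
    refine h.trans (Nat.mul_le_mul_left _ (card_le_card fun σ hx => ?_))
    simp only [mem_filter, mem_univ, true_and, not_exists] at hx ⊢
    exact hx.2
  · refine bound (fun q => (σ q).1 = p.1) (fun q => q.1 = p.1)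
      (fun q => ∃ y : V × Fin r, y.1 = p.1 ∧ (σ q).1 = (σ y).1)
      (fun q => ∃ y : V × Fin r, (σ y).1 = p.1 ∧ (σ q).1 = y.1) (fun q => q.1 = p.1)
      (hs _ _) (ht _) (card_exists_le _ _ (ht _) fun _ => hs _ _)
      (card_exists_le _ _ (hs _ _) fun _ => hs _ _) (ht _) _ ?_
    rintro q ⟨y, hy⟩
    by_cases hp : y = p
    · subst hp
      simp [Conflict] at hy
      exact Or.inl hy
    by_cases hq : y = q
    · subst hq
      simp [Conflict, hσ] at hy
      exact Or.inr (Or.inl hy.2.1.symm)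
    simp only [Conflict, Perm.mul_apply, swap_apply_left, swap_apply_of_ne_of_ne hp hq] at hy
    rcases hy with hy | hy
    · exact Or.inr (Or.inr (Or.inl ⟨y, hy.2.1.symm, hy.2.2⟩))
    · exact Or.inr (Or.inr (Or.inr (Or.inl ⟨y, hy.2, hy.1⟩)))
  · refine bound (fun q => (σ q).1 = p.1) (fun q => (σ p).1 = q.1)
      (fun q => ∃ y : V × Fin r, (σ y).1 = (σ p).1 ∧ q.1 = y.1)
      (fun q => ∃ y : V × Fin r, y.1 = (σ p).1 ∧ (σ y).1 = q.1) (fun q => q.1 = p.1)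
      (hs _ _) (ht' _) (card_exists_le _ _ (hs _ _) fun _ => ht _)
      (card_exists_le _ _ (ht _) fun _ => ht' _) (ht _) _ ?_
    rintro q (⟨y, hy⟩ | hy)
    · by_cases hq : y = q
      · subst hq
        simp [Conflict] at hy
        exact Or.inr (Or.inl hy)
      by_cases hp : y = p
      · subst hp
        simp [Conflict, hσ] at hy
        exact Or.inr (Or.inr (Or.inr (Or.inr hy.2.1)))
      simp only [Conflict, Perm.mul_apply, swap_apply_right, swap_apply_of_ne_of_ne hp hq] at hy
      rcases hy with hy | hy
      · exact Or.inr (Or.inr (Or.inl ⟨y, hy.2.2.symm, hy.2.1⟩))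
      · exact Or.inr (Or.inr (Or.inr (Or.inl ⟨y, hy.1.symm, hy.2⟩)))
    -- Points other than p and q keep their images, so a new loop can only sit at p or q.
    · push Not at hy
      obtain ⟨x, hx⟩ := hy
      by_cases hp : x = p
      · subst hp
        simp at hx
        exact Or.inl hx
      by_cases hq : x = q
      · subst hq
        simp at hx
        exact Or.inr (Or.inl hx)
      simp [swap_apply_of_ne_of_ne hp hq, hσ] at hx
  · obtain ⟨y, hy⟩ := h3
    have hsymm : Conflict (σ * swap p q) y x := by
      rcases hy with hy | hy
      · exact Or.inl ⟨hy.1.symm, hy.2.1.symm, hy.2.2.symm⟩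
      · exact Or.inr ⟨hy.2, hy.1⟩
    have hp : x ≠ p := by rintro rfl; exact h1 ⟨_, hy⟩
    have hq : x ≠ q := by rintro rfl; exact h2 ⟨_, hy⟩
    have hp' : y ≠ p := by rintro rfl; exact h1 ⟨_, hsymm⟩
    have hq' : y ≠ q := by rintro rfl; exact h2 ⟨_, hsymm⟩
    refine ⟨y, ?_⟩
    simpa [Conflict, swap_apply_of_ne_of_ne hp hq, swap_apply_of_ne_of_ne hp' hq'] using hy

/-- At least a polynomial fraction of all configurations comes from an oriented graph. -/
theorem card_perm_le_conflictFree (hr : 4 * (2 * r ^ 2 + 4 * r) ≤ Fintype.card V * r) :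
    Fintype.card (Perm (V × Fin r)) ≤ (Fintype.card V * r + 1) ^ (4 * r ^ 2 + 10 * r) *
      #{σ : Perm (V × Fin r) | ∀ x y, ¬ Conflict σ x y} := by
  refine (card_le_loopless (by nlinarith)).trans ?_
  refine (Nat.mul_le_mul_left _ (card_loopless_le hr)).trans_eq ?_
  rw [← mul_assoc, ← pow_add]
  ring_nf

end Points

end RandDigraph

/-! ### From configurations to regular oriented graphs -/

namespace RandDigraph

open Finset Equiv

/-- The digraph of a configuration. -/
def configDigraph {V I : Type*} (σ : Perm (V × I)) : Digraph V :=
  ⟨fun v w => ∃ i, (σ (v, i)).1 = w⟩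

section Fibre

variable {V : Type*} {r : ℕ}

theorem configDigraph_adj_iff_symm (σ : Perm (V × Fin r)) (v w : V) :
    (configDigraph σ).Adj v w ↔ ∃ j, (σ.symm (w, j)).1 = v := by
  constructor
  · rintro ⟨i, rfl⟩
    exact ⟨(σ (v, i)).2, by simp⟩
  · rintro ⟨j, rfl⟩
    exact ⟨(σ.symm (w, j)).2, by simp⟩

theorem injective_out {σ : Perm (V × Fin r)} (h : ∀ x y, ¬ Conflict σ x y) (v : V) :
    Function.Injective fun i => (σ (v, i)).1 := fun i j hij => by
  by_contra hne
  exact h (v, i) (v, j) (Or.inl ⟨by simpa using hne, rfl, hij⟩)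

theorem injective_in {σ : Perm (V × Fin r)} (h : ∀ x y, ¬ Conflict σ x y) (w : V) :
    Function.Injective fun j => (σ.symm (w, j)).1 := fun i j hij => by
  by_contra hne
  refine h (σ.symm (w, i)) (σ.symm (w, j)) (Or.inl ⟨by simpa using hne, hij, by simp⟩)

theorem isOriented_configDigraph {σ : Perm (V × Fin r)} (h : ∀ x y, ¬ Conflict σ x y) :
    IsOriented (configDigraph σ) := by
  refine ⟨?_, ?_⟩
  · rintro v ⟨i, hi⟩
    exact h (v, i) (v, i) (Or.inr ⟨hi, hi⟩)
  · rintro v w ⟨i, hi⟩ ⟨j, hj⟩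
    exact h (v, i) (w, j) (Or.inr ⟨hi, hj⟩)

theorem isRegular_configDigraph {σ : Perm (V × Fin r)} (h : ∀ x y, ¬ Conflict σ x y) :
    IsRegular r (configDigraph σ) := by
  have hr : (Set.univ : Set (Fin r)).ncard = r := by simp [Set.ncard_univ]
  refine fun v => ⟨?_, ?_⟩
  · have : {w | (configDigraph σ).Adj v w} = (fun i => (σ (v, i)).1) '' Set.univ := by
      ext w; simp [configDigraph]
    rw [this, Set.ncard_image_of_injective _ (injective_out h v), hr]
  · have : {w | (configDigraph σ).Adj w v} = (fun i => (σ.symm (v, i)).1) '' Set.univ := by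
      ext w; simp [configDigraph_adj_iff_symm]
    rw [this, Set.ncard_image_of_injective _ (injective_in h v), hr]

/-- The configuration obtained from a digraph by numbering the out-arcs and the in-arcs at every
vertex. -/
def configOfNumbering (D : Digraph V) (o : ∀ v, Fin r ≃ {w // D.Adj v w})
    (ι : ∀ w, Fin r ≃ {v // D.Adj v w}) : Perm (V × Fin r) where
  toFun x := ((o x.1 x.2).1, (ι (o x.1 x.2).1).symm ⟨x.1, (o x.1 x.2).2⟩)
  invFun x := ((ι x.1 x.2).1, (o (ι x.1 x.2).1).symm ⟨x.1, (ι x.1 x.2).2⟩)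
  left_inv := by
    rintro ⟨v, i⟩
    -- The numbering used in the second coordinate depends on the vertex y, so y is generalised
    -- before substituting.
    have key : ∀ y : {v' // D.Adj v' (o v i).1}, y = ⟨v, (o v i).2⟩ →
        (y.1, (o y.1).symm ⟨(o v i).1, y.2⟩) = (v, i) := by
      rintro y rfl
      simp
    exact key _ (Equiv.apply_symm_apply _ _)
  right_inv := by
    rintro ⟨w, j⟩
    have key : ∀ y : {w' // D.Adj (ι w j).1 w'}, y = ⟨w, (ι w j).2⟩ →
        (y.1, (ι y.1).symm ⟨(ι w j).1, y.2⟩) = (w, j) := by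
      rintro y rfl
      simp
    exact key _ (Equiv.apply_symm_apply _ _)

theorem configDigraph_configOfNumbering (D : Digraph V) (o : ∀ v, Fin r ≃ {w // D.Adj v w})
    (ι : ∀ w, Fin r ≃ {v // D.Adj v w}) : configDigraph (configOfNumbering D o ι) = D := by
  ext v w
  simp only [configDigraph, configOfNumbering, Equiv.coe_fn_mk]
  constructor
  · rintro ⟨i, rfl⟩
    exact (o v i).2
  · intro h
    exact ⟨(o v).symm ⟨w, h⟩, by simp⟩

theorem conflictFree_configOfNumbering {D : Digraph V} (hD : IsOriented D)
    (o : ∀ v, Fin r ≃ {w // D.Adj v w}) (ι : ∀ w, Fin r ≃ {v // D.Adj v w}) (x y : V × Fin r) :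
    ¬ Conflict (configOfNumbering D o ι) x y := by
  obtain ⟨v, i⟩ := x
  obtain ⟨w, j⟩ := y
  rintro (⟨h1, h2, h3⟩ | ⟨h1, h2⟩)
  · simp only at h2
    subst h2
    exact h1 (congrArg _ ((o v).injective (Subtype.ext h3)))
  · simp only [configOfNumbering, Equiv.coe_fn_mk] at h1 h2
    exact hD.2 v w (h1 ▸ (o v i).2) (h2 ▸ (o w j).2)

theorem exists_numbering {D : Digraph V} (σ : Perm (V × Fin r)) (h : ∀ x y, ¬ Conflict σ x y)
    (hσ : configDigraph σ = D) :
    ∃ (o : ∀ v, Fin r ≃ {w // D.Adj v w}) (ι : ∀ w, Fin r ≃ {v // D.Adj v w}),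
      configOfNumbering D o ι = σ := by
  subst hσ
  let o (v : V) : Fin r ≃ {w // (configDigraph σ).Adj v w} :=
    Equiv.ofBijective (fun i => ⟨(σ (v, i)).1, ⟨i, rfl⟩⟩)
      ⟨fun i j hij => injective_out h v (Subtype.ext_iff.1 hij),
        fun ⟨w, i, hi⟩ => ⟨i, Subtype.ext hi⟩⟩
  let ι (w : V) : Fin r ≃ {v // (configDigraph σ).Adj v w} :=
    Equiv.ofBijective (fun j => ⟨(σ.symm (w, j)).1,
        (configDigraph_adj_iff_symm σ _ w).2 ⟨j, rfl⟩⟩)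
      ⟨fun i j hij => injective_in h w (Subtype.ext_iff.1 hij), fun ⟨v, hv⟩ => by
        obtain ⟨j, hj⟩ := (configDigraph_adj_iff_symm σ v w).1 hv
        exact ⟨j, Subtype.ext hj⟩⟩
  refine ⟨o, ι, Equiv.ext ?_⟩
  rintro ⟨v, i⟩
  refine Prod.ext rfl ?_
  change (ι (σ (v, i)).1).symm ⟨v, _⟩ = (σ (v, i)).2
  rw [Equiv.symm_apply_eq]
  refine Subtype.ext ?_
  change v = (σ.symm ((σ (v, i)).1, (σ (v, i)).2)).1
  simp

theorem configOfNumbering_injective (D : Digraph V) :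
    Function.Injective fun a : (∀ v, Fin r ≃ {w // D.Adj v w}) × (∀ w, Fin r ≃ {v // D.Adj v w}) =>
      configOfNumbering D a.1 a.2 := by
  rintro ⟨o, ι⟩ ⟨o', ι'⟩ h
  simp only at h
  refine Prod.ext (funext fun v => Equiv.ext fun i => Subtype.ext ?_)
    (funext fun w => Equiv.ext fun j => Subtype.ext ?_)
  · exact congrArg (fun σ : Perm (V × Fin r) => (σ (v, i)).1) h
  · exact congrArg (fun σ : Perm (V × Fin r) => (σ.symm (w, j)).1) h

/-- Every `r`-regular oriented graph comes from the same number of configurations. -/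
theorem natCard_fibre [Fintype V] {D : Digraph V} (hD : IsOriented D) (hr : IsRegular r D) :
    Nat.card {σ : Perm (V × Fin r) // (∀ x y, ¬ Conflict σ x y) ∧ configDigraph σ = D} =
      (r.factorial ^ Fintype.card V) * r.factorial ^ Fintype.card V := by
  classical
  let F : (∀ v, Fin r ≃ {w // D.Adj v w}) × (∀ w, Fin r ≃ {v // D.Adj v w}) →
      {σ : Perm (V × Fin r) // (∀ x y, ¬ Conflict σ x y) ∧ configDigraph σ = D} := fun a =>
    ⟨configOfNumbering D a.1 a.2, conflictFree_configOfNumbering hD a.1 a.2,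
      configDigraph_configOfNumbering D a.1 a.2⟩
  have hF : Function.Bijective F := by
    refine ⟨fun a b h => configOfNumbering_injective D (Subtype.ext_iff.1 h), ?_⟩
    rintro ⟨σ, h, hσ⟩
    obtain ⟨o, ι, e⟩ := exists_numbering σ h hσ
    exact ⟨(o, ι), Subtype.ext e⟩
  have card_out (v : V) : Nat.card (Fin r ≃ {w // D.Adj v w}) = r.factorial := by
    have : Nat.card {w // D.Adj v w} = r := (hr v).1
    rw [Nat.card_eq_fintype_card, Fintype.card_equiv (Fintype.equivOfCardEq (by
      rw [← Nat.card_eq_fintype_card, ← Nat.card_eq_fintype_card, this]; simp)), Fintype.card_fin]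
  have card_in (v : V) : Nat.card (Fin r ≃ {w // D.Adj w v}) = r.factorial := by
    have : Nat.card {w // D.Adj w v} = r := (hr v).2
    rw [Nat.card_eq_fintype_card, Fintype.card_equiv (Fintype.equivOfCardEq (by
      rw [← Nat.card_eq_fintype_card, ← Nat.card_eq_fintype_card, this]; simp)), Fintype.card_fin]
  rw [← Nat.card_congr (Equiv.ofBijective F hF), Nat.card_prod, Nat.card_pi, Nat.card_pi,
    prod_congr rfl fun v _ => card_out v, prod_congr rfl fun v _ => card_in v]
  simp

end Fibre

/-- All fibres have equal size, so a uniform conflict-free configuration yields a uniform regular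
oriented graph. -/
theorem card_conflictFree_filter (n r : ℕ) (P : Digraph (Fin n) → Prop) [DecidablePred P] :
    #{σ : Perm (Fin n × Fin r) | (∀ x y, ¬ Conflict σ x y) ∧ P (configDigraph σ)} =
      #((regularOriented n r).filter P) * (r.factorial ^ n * r.factorial ^ n) := by
  classical
  rw [card_eq_sum_card_fiberwise (f := configDigraph) (t := (regularOriented n r).filter P),
    sum_const_nat fun D hD => ?_]
  · simp only [regularOriented, mem_filter, mem_univ, true_and] at hD
    have := natCard_fibre hD.1.1 hD.1.2
    rw [Fintype.card_fin, Nat.card_eq_fintype_card, Fintype.card_subtype] at this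
    rw [← this, filter_filter]
    congr 1
    refine filter_congr fun σ _ => ?_
    constructor
    · rintro ⟨⟨h, _⟩, h'⟩
      exact ⟨h, h'⟩
    · rintro ⟨h, h'⟩
      exact ⟨⟨h, h' ▸ hD.2⟩, h'⟩
  · intro σ hσ
    simp only [coe_filter, mem_univ, true_and, Set.mem_ofPred_eq] at hσ
    simp only [regularOriented, coe_filter, mem_filter, mem_univ, true_and, Set.mem_ofPred_eq]
    exact ⟨⟨isOriented_configDigraph hσ.1, isRegular_configDigraph hσ.1⟩, hσ.2⟩

theorem factorial_le_card_regularOriented {n r : ℕ} (hn : 4 * (2 * r ^ 2 + 4 * r) ≤ n * r) :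
    (n * r).factorial ≤ (n * r + 1) ^ (4 * r ^ 2 + 10 * r) *
      (#(regularOriented n r) * (r.factorial ^ n * r.factorial ^ n)) := by
  classical
  have h := card_perm_le_conflictFree (V := Fin n) (r := r) (by simpa using hn)
  have h2 := card_conflictFree_filter n r fun _ => True
  simp only [and_true, filter_true] at h2
  rw [Fintype.card_perm, Fintype.card_prod, Fintype.card_fin, Fintype.card_fin] at h
  rw [← h2]
  convert h

theorem card_regularOriented_pos {n r : ℕ} (hn : 4 * (2 * r ^ 2 + 4 * r) ≤ n * r) :
    0 < #(regularOriented n r) := by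
  have h := factorial_le_card_regularOriented hn
  by_contra h0
  rw [Nat.pos_iff_ne_zero, not_not] at h0
  rw [h0] at h
  simp [Nat.factorial_ne_zero] at h

/-- Transfer from the configuration model to random regular oriented graphs. -/
theorem card_regularOriented_filter_le {n r : ℕ} (hn : 4 * (2 * r ^ 2 + 4 * r) ≤ n * r)
    (P : Digraph (Fin n) → Prop) [DecidablePred P] {F : Finset (Perm (Fin n × Fin r))}
    (hF : ∀ σ, P (configDigraph σ) → σ ∈ F) :
    #((regularOriented n r).filter P) * (n * r).factorial ≤
      (n * r + 1) ^ (4 * r ^ 2 + 10 * r) * #(regularOriented n r) * #F := by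
  classical
  have h := factorial_le_card_regularOriented hn
  have h1 : #((regularOriented n r).filter P) * (r.factorial ^ n * r.factorial ^ n) ≤ #F := by
    refine (card_conflictFree_filter n r P).symm.trans_le (card_le_card fun σ hσ => ?_)
    exact hF σ (mem_filter.1 hσ).2.2
  calc _ ≤ #((regularOriented n r).filter P) * ((n * r + 1) ^ (4 * r ^ 2 + 10 * r) *
      (#(regularOriented n r) * (r.factorial ^ n * r.factorial ^ n))) := Nat.mul_le_mul_left _ h
    _ = (n * r + 1) ^ (4 * r ^ 2 + 10 * r) * #(regularOriented n r) *
      (#((regularOriented n r).filter P) * (r.factorial ^ n * r.factorial ^ n)) := by ring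
    _ ≤ _ := Nat.mul_le_mul_left _ h1

end RandDigraph

/-! ### Comparison with binomial random sets -/

namespace RandDigraph

open Finset Equiv

/-- The image of a `k`-set under a uniformly random permutation is a uniformly random `k`-set. -/
theorem card_perm_map_mem {X : Type*} [Fintype X] [DecidableEq X] (P : Finset X)
    (F : Finset (Finset X)) (hF : ∀ T ∈ F, #T = #P) :
    #{σ : Perm X | P.map σ.toEmbedding ∈ F} * (Fintype.card X).choose #P =
      #F * (Fintype.card X).factorial := by
  have fibre : ∀ T : Finset X, #T = #P →
      #{σ : Perm X | P.map σ.toEmbedding = T} = #{σ : Perm X | P.map σ.toEmbedding = P} := by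
    intro T hT
    obtain ⟨τ, hτ⟩ : ∃ τ : Perm X, P.map τ.toEmbedding = T := by
      let e : {x // x ∈ P} ≃ {x // x ∈ T} := Finset.equivOfCardEq hT.symm
      refine ⟨e.extendSubtype, Finset.eq_of_subset_of_card_le ?_ (by simp [hT])⟩
      intro y hy
      obtain ⟨x, hx, rfl⟩ := Finset.mem_map.1 hy
      exact e.extendSubtype_mem x hx
    -- Left multiplication by τ carries the permutations preserving P to those taking P to T.
    symm
    refine card_bij (fun σ _ => τ * σ) ?_ (fun _ _ _ _ h => mul_left_cancel h) ?_
    · intro σ hσ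
      simp only [mem_filter, mem_univ, true_and] at hσ ⊢
      rw [← hτ]
      conv_rhs => rw [← hσ]
      rw [Finset.map_map]
      rfl
    · intro σ hσ
      simp only [mem_filter, mem_univ, true_and] at hσ
      refine ⟨τ⁻¹ * σ, ?_, by simp⟩
      simp only [mem_filter, mem_univ, true_and]
      have : P.map (τ⁻¹ * σ).toEmbedding = (P.map σ.toEmbedding).map (τ⁻¹).toEmbedding := by
        rw [Finset.map_map]; rfl
      rw [this, hσ, ← hτ, Finset.map_map]
      ext x
      simp
  have count : ∀ G : Finset (Finset X), (∀ T ∈ G, #T = #P) →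
      #{σ : Perm X | P.map σ.toEmbedding ∈ G} =
        #G * #{σ : Perm X | P.map σ.toEmbedding = P} := by
    intro G hG
    rw [card_eq_sum_card_fiberwise (f := fun σ : Perm X => P.map σ.toEmbedding) (t := G),
      sum_const_nat fun T hT => ?_]
    · rw [← fibre T (hG T hT), filter_filter]
      congr 1
      refine filter_congr fun σ _ => and_iff_right_of_imp ?_
      rintro rfl
      exact hT
    · intro σ hσ
      simpa using hσ
  -- Applying the count to all sets of size #P determines the common fibre size.
  have hall := count (powersetCard #P univ) fun T hT => (mem_powersetCard.1 hT).2
  rw [card_powersetCard, card_univ, filter_true_of_mem fun σ _ => by simp [mem_powersetCard],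
    card_univ, Fintype.card_perm] at hall
  rw [count F hF, hall]
  ring

/-- The largest term in the binomial expansion of `(k + (N - k)) ^ N`. -/
theorem binomial_term_le {N k j : ℕ} (hk : k ≤ N) (hj : j ≤ N) :
    k ^ j * (N - k) ^ (N - j) * N.choose j ≤ k ^ k * (N - k) ^ (N - k) * N.choose k := by
  set f : ℕ → ℕ := fun j => k ^ j * (N - k) ^ (N - j) * N.choose j with hf
  -- The ratio of consecutive terms, k(N-i) / ((i+1)(N-k)), is at least 1 for i < k and at most 1
  -- for i ≥ k; the cases k = N and k = 0, where cancelling fails, are treated apart.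
  have step : ∀ i < N, f (i + 1) * ((i + 1) * (N - k)) = f i * (k * (N - i)) := by
    intro i hi
    have h1 := Nat.choose_succ_right_eq N i
    have h2 : N - i = (N - (i + 1)) + 1 := by omega
    simp only [hf]
    conv_rhs => rw [h2]
    rw [h2] at h1
    calc _ = k ^ i * k * (N - k) ^ (N - (i + 1)) * (N - k) * (N.choose (i + 1) * (i + 1)) := by
          ring
      _ = _ := by rw [h1]; ring
  change f j ≤ f k
  rcases le_total j k with h | h
  · induction h using Nat.decreasingInduction with
    | self => exact le_rfl
    | of_succ i hi ih =>
      refine le_trans ?_ (ih (by omega))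
      have hs := step i (by omega)
      by_cases hNk : N = k
      · have : f i = 0 := by
          simp only [hf]
          rw [hNk, Nat.sub_self, zero_pow (by omega)]
          simp
        omega
      have hpos : 0 < (i + 1) * (N - k) := Nat.mul_pos (by omega) (by omega)
      refine le_of_mul_le_mul_right ?_ hpos
      rw [hs]
      exact Nat.mul_le_mul_left _ (Nat.mul_le_mul hi (by omega))
  · induction j, h using Nat.le_induction with
    | base => exact le_rfl
    | succ i hi ih =>
      refine le_trans ?_ (ih (by omega))
      have hs := step i (by omega)
      by_cases hk0 : k = 0
      · have : f (i + 1) = 0 := by simp [hf, hk0]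
        omega
      have hpos : 0 < k * (N - i) := Nat.mul_pos (by omega) (by omega)
      refine le_of_mul_le_mul_right ?_ hpos
      rw [← hs]
      refine Nat.mul_le_mul_left _ ?_
      obtain ⟨d, rfl⟩ := Nat.exists_eq_add_of_le hi
      obtain ⟨e, rfl⟩ := Nat.exists_eq_add_of_le hj
      have e1 : k + d + 1 + e - (k + d) = e + 1 := by omega
      have e2 : k + d + 1 + e - k = d + 1 + e := by omega
      rw [e1, e2]
      nlinarith [Nat.zero_le (d * e), Nat.zero_le (d * d)]

theorem pow_le_mul_binomial_term {N k : ℕ} (hk : k ≤ N) :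
    N ^ N ≤ (N + 1) * (k ^ k * (N - k) ^ (N - k) * N.choose k) := by
  have h : (k + (N - k)) ^ N = ∑ j ∈ range (N + 1), k ^ j * (N - k) ^ (N - j) * N.choose j :=
    add_pow _ _ _
  rw [Nat.add_sub_cancel' hk] at h
  conv_lhs => rw [h]
  refine (sum_le_card_nsmul _ _ _ fun j hj =>
    binomial_term_le hk (Nat.lt_succ_iff.1 (mem_range.1 hj))).trans_eq ?_
  simp

/-- The binomial distribution with parameters N and k/N has its mode at k, and only N + 1 values.
The factor N + 1 is the price of conditioning a binomial set on its size. -/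
theorem one_le_mul_binomial_prob {N k : ℕ} (hk : k ≤ N) :
    (1 : ℝ) ≤ (N + 1) * (((k : ℝ) / N) ^ k * (1 - (k : ℝ) / N) ^ (N - k) * N.choose k) := by
  rcases Nat.eq_zero_or_pos N with rfl | hN
  · obtain rfl : k = 0 := by omega
    simp
  have h : ((N : ℝ)) ^ N ≤ (N + 1) * (k ^ k * ((N - k : ℕ) : ℝ) ^ (N - k) * N.choose k) := by
    exact_mod_cast pow_le_mul_binomial_term hk
  have hN' : (0 : ℝ) < N := by exact_mod_cast hN
  have e : (1 - (k : ℝ) / N) = ((N - k : ℕ) : ℝ) / N := by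
    rw [Nat.cast_sub hk]; field_simp
  have e2 : (N : ℝ) ^ N = N ^ k * N ^ (N - k) := by rw [← pow_add, Nat.add_sub_cancel' hk]
  rw [e, div_pow, div_pow]
  rw [← div_le_div_iff_of_pos_right (show (0 : ℝ) < N ^ N by positivity), div_self (by positivity)] at h
  refine h.trans_eq ?_
  rw [e2]
  field_simp

/-- The fibre of a set of points over a vertex. -/
def slice {V : Type*} [DecidableEq V] {r : ℕ} (T : Finset (V × Fin r)) (v : V) : Finset (Fin r) :=
  {i | (v, i) ∈ T}

theorem slice_injective {V : Type*} [DecidableEq V] {r : ℕ} :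
    Function.Injective (slice : Finset (V × Fin r) → V → Finset (Fin r)) := by
  intro S T h
  ext ⟨v, i⟩
  have := congrArg (i ∈ ·) (congrFun h v)
  simpa [slice] using this

section Slices

variable {V : Type*} [Fintype V] [DecidableEq V] {r : ℕ}

theorem card_eq_sum_slice (T : Finset (V × Fin r)) : #T = ∑ v, #(slice T v) := by
  rw [card_eq_sum_card_fiberwise (f := Prod.fst) (t := univ) (by simp)]
  refine sum_congr rfl fun v _ => ?_
  refine card_bij (fun x _ => x.2) ?_ ?_ ?_
  · rintro ⟨u, i⟩ h
    simp only [mem_filter] at h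
    obtain ⟨h, rfl⟩ := h
    simpa [slice] using h
  · rintro ⟨u, i⟩ h ⟨u', i'⟩ h' hi
    simp only [mem_filter] at h h' hi
    rw [h.2, h'.2, hi]
  · intro i hi
    exact ⟨(v, i), by simpa [slice] using hi, rfl⟩

theorem weight_eq_prod_slice (p : ℝ) (T : Finset (V × Fin r)) :
    p ^ #T * (1 - p) ^ (Fintype.card V * r - #T) =
      ∏ v, p ^ #(slice T v) * (1 - p) ^ (r - #(slice T v)) := by
  rw [prod_mul_distrib, prod_pow_eq_pow_sum, prod_pow_eq_pow_sum, ← card_eq_sum_slice]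
  congr 2
  have h : ∑ v : V, (r - #(slice T v)) + ∑ v, #(slice T v) = Fintype.card V * r := by
    rw [← sum_add_distrib, sum_congr rfl fun v _ => Nat.sub_add_cancel
      ((card_le_univ (slice T v)).trans_eq (Fintype.card_fin r))]
    simp
  rw [← card_eq_sum_slice] at h
  omega

/-- Independence of the slices: expanding the product sums over all admissible families of slices,
and a set is determined by its slices. -/
theorem sum_weight_le_prod {p : ℝ} (hp0 : 0 ≤ p) (hp1 : 0 ≤ 1 - p)
    (F : Finset (Finset (V × Fin r))) (t : V → Finset (Finset (Fin r)))
    (hF : ∀ T ∈ F, ∀ v, slice T v ∈ t v) :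
    ∑ T ∈ F, p ^ #T * (1 - p) ^ (Fintype.card V * r - #T) ≤
      ∏ v, ∑ S ∈ t v, p ^ #S * (1 - p) ^ (r - #S) := by
  classical
  rw [prod_univ_sum, sum_congr rfl fun T _ => weight_eq_prod_slice p T]
  let w : (V → Finset (Fin r)) → ℝ := fun g => ∏ v, p ^ #(g v) * (1 - p) ^ (r - #(g v))
  have hw : ∀ g, 0 ≤ w g := fun g => prod_nonneg fun v _ =>
    mul_nonneg (pow_nonneg hp0 _) (pow_nonneg hp1 _)
  have e : ∑ T ∈ F, w (slice T) = ∑ g ∈ F.map ⟨slice, slice_injective⟩, w g :=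
    (sum_map F ⟨slice, slice_injective⟩ w).symm
  change ∑ T ∈ F, w (slice T) ≤ ∑ g ∈ Fintype.piFinset t, w g
  rw [e]
  refine sum_le_sum_of_subset_of_nonneg ?_ fun g _ _ => hw g
  intro g hg
  obtain ⟨T, hT, rfl⟩ := Finset.mem_map.1 hg
  exact Fintype.mem_piFinset.2 (hF T hT)

/-- In the configuration model, the in-points hit from a set `B` of vertices behave, up to a
polynomial factor, like a binomial random set of points. -/
theorem card_perm_slice_le (hr : 0 < r) (B : Finset V) (t : V → Finset (Finset (Fin r))) :
    (#{σ : Perm (V × Fin r) | ∀ v, slice ((B ×ˢ univ).map σ.toEmbedding) v ∈ t v} : ℝ) ≤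
      (Fintype.card V * r).factorial * (Fintype.card V * r + 1) *
        ∏ v, ∑ S ∈ t v, ((#B : ℝ) / Fintype.card V) ^ #S *
          (1 - (#B : ℝ) / Fintype.card V) ^ (r - #S) := by
  set p : ℝ := (#B : ℝ) / Fintype.card V with hp
  have hp0 : 0 ≤ p := by positivity
  have hp1 : 0 ≤ 1 - p := by
    rw [sub_nonneg]
    exact div_le_one_of_le₀ (by exact_mod_cast card_le_univ B) (by positivity)
  let F : Finset (Finset (V × Fin r)) := {T | #T = #B * r ∧ ∀ v, slice T v ∈ t v}
  have hP : #(B ×ˢ (univ : Finset (Fin r))) = #B * r := by simp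
  have h1 := card_perm_map_mem (B ×ˢ (univ : Finset (Fin r))) F (by
    intro T hT
    rw [hP]
    exact (mem_filter.1 hT).2.1)
  have hN : Fintype.card (V × Fin r) = Fintype.card V * r := by simp
  rw [hN, hP] at h1
  have hk : #B * r ≤ Fintype.card V * r := Nat.mul_le_mul_right _ (card_le_univ B)
  have h2 := one_le_mul_binomial_prob hk
  have hpk : ((#B * r : ℕ) : ℝ) / ((Fintype.card V * r : ℕ) : ℝ) = p := by
    rw [hp]; push_cast
    have : (r : ℝ) ≠ 0 := by positivity
    field_simp
  rw [hpk] at h2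
  have h3 : ∑ T ∈ F, p ^ #T * (1 - p) ^ (Fintype.card V * r - #T) ≤
      ∏ v, ∑ S ∈ t v, p ^ #S * (1 - p) ^ (r - #S) :=
    sum_weight_le_prod hp0 hp1 F t fun T hT => (mem_filter.1 hT).2.2
  rw [sum_congr rfl fun T hT => by rw [(mem_filter.1 hT).2.1], sum_const, nsmul_eq_mul] at h3
  have h4 : (#{σ : Perm (V × Fin r) | ∀ v, slice ((B ×ˢ univ).map σ.toEmbedding) v ∈ t v} : ℝ) =
      #{σ : Perm (V × Fin r) | (B ×ˢ univ).map σ.toEmbedding ∈ F} := by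
    congr 2
    refine filter_congr fun σ _ => ?_
    simp [F]
  rw [h4]
  have h1' : (#{σ : Perm (V × Fin r) | (B ×ˢ univ).map σ.toEmbedding ∈ F} : ℝ) *
      (Fintype.card V * r).choose (#B * r) = #F * (Fintype.card V * r).factorial := by
    exact_mod_cast h1
  set M : ℝ := (#{σ : Perm (V × Fin r) | (B ×ˢ univ).map σ.toEmbedding ∈ F} : ℝ)
  push_cast at h2
  calc M = M * 1 := (mul_one M).symm
    _ ≤ M * (((Fintype.card V : ℝ) * r + 1) * (p ^ (#B * r) *
        (1 - p) ^ (Fintype.card V * r - #B * r) * (Fintype.card V * r).choose (#B * r))) :=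
        mul_le_mul_of_nonneg_left h2 (Nat.cast_nonneg _)
    _ = (M * (Fintype.card V * r).choose (#B * r)) * ((Fintype.card V : ℝ) * r + 1) *
        (p ^ (#B * r) * (1 - p) ^ (Fintype.card V * r - #B * r)) := by ring
    _ = (Fintype.card V * r).factorial * (Fintype.card V * r + 1) *
        (#F * (p ^ (#B * r) * (1 - p) ^ (Fintype.card V * r - #B * r))) := by rw [h1']; ring
    _ ≤ _ := mul_le_mul_of_nonneg_left h3 (by positivity)

theorem mem_slice_map (σ : Perm (V × Fin r)) (B : Finset V) (v : V) (j : Fin r) :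
    j ∈ slice ((B ×ˢ univ).map σ.toEmbedding) v ↔ (σ.symm (v, j)).1 ∈ B := by
  simp only [slice, mem_filter, mem_univ, true_and, Finset.mem_map, mem_product, and_true,
    Equiv.coe_toEmbedding]
  constructor
  · rintro ⟨x, hx, h⟩
    rw [← h]
    simpa using hx
  · intro h
    exact ⟨_, h, by simp⟩

/-- `A` out-dominates `D`: every vertex outside `A` has an in-neighbour in `A`. -/
def IsDominating {V : Type*} (D : Digraph V) (A : Finset V) : Prop :=
  ∀ v, v ∉ A → ∃ u ∈ A, D.Adj u v

theorem sum_all_weight (p : ℝ) : ∑ S : Finset (Fin r), p ^ #S * (1 - p) ^ (r - #S) = 1 := by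
  have := Fintype.sum_pow_mul_eq_add_pow (Fin r) p (1 - p)
  simpa using this

/-- The slice at v marks the in-arcs of v coming from A. Domination makes it non-empty for v outside
A, an event of binomial probability 1 - (1 - p)^r. -/
theorem card_perm_isDominating_le (hr : 0 < r) (A : Finset V)
    [DecidablePred fun σ : Perm (V × Fin r) => IsDominating (configDigraph σ) A] :
    (#{σ : Perm (V × Fin r) | IsDominating (configDigraph σ) A} : ℝ) ≤
      (Fintype.card V * r).factorial * (Fintype.card V * r + 1) *
        (1 - (1 - (#A : ℝ) / Fintype.card V) ^ r) ^ (Fintype.card V - #A) := by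
  refine le_trans (Nat.cast_le.2 (card_le_card ?_)) ((card_perm_slice_le hr A
    (fun v => if v ∈ A then univ else univ.erase ∅)).trans_eq ?_)
  · intro σ hσ
    simp only [mem_filter, mem_univ, true_and] at hσ ⊢
    intro v
    split_ifs with hv
    · simp
    · obtain ⟨u, hu, h⟩ := hσ v hv
      obtain ⟨j, hj⟩ := (configDigraph_adj_iff_symm σ u v).1 h
      simp only [mem_erase, mem_univ, and_true]
      exact ne_empty_of_mem ((mem_slice_map σ A v j).2 (hj ▸ hu))
  · congr 1
    set p : ℝ := (#A : ℝ) / Fintype.card V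
    have : ∀ v, ∑ S ∈ (if v ∈ A then univ else univ.erase ∅ : Finset (Finset (Fin r))),
        p ^ #S * (1 - p) ^ (r - #S) = if v ∈ A then 1 else 1 - (1 - p) ^ r := by
      intro v
      split_ifs
      · exact sum_all_weight p
      · rw [sum_erase_eq_sub (mem_univ _), sum_all_weight]
        simp
    rw [prod_congr rfl fun v _ => this v, prod_ite]
    simp [filter_not, card_sdiff]

/-- Now the slices mark in-arcs coming from B, and those over A must be empty. -/
theorem card_perm_noArc_le (hr : 0 < r) (A B : Finset V)
    [DecidablePred fun σ : Perm (V × Fin r) => ∀ b ∈ B, ∀ a ∈ A, ¬ (configDigraph σ).Adj b a] :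
    (#{σ : Perm (V × Fin r) | ∀ b ∈ B, ∀ a ∈ A, ¬ (configDigraph σ).Adj b a} : ℝ) ≤
      (Fintype.card V * r).factorial * (Fintype.card V * r + 1) *
        ((1 - (#B : ℝ) / Fintype.card V) ^ r) ^ #A := by
  refine le_trans (Nat.cast_le.2 (card_le_card ?_)) ((card_perm_slice_le hr B
    (fun v => if v ∈ A then {∅} else univ)).trans_eq ?_)
  · intro σ hσ
    simp only [mem_filter, mem_univ, true_and] at hσ ⊢
    intro v
    split_ifs with hv
    · rw [mem_singleton, eq_empty_iff_forall_notMem]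
      intro j hj
      exact hσ _ ((mem_slice_map σ B v j).1 hj) v hv
        ((configDigraph_adj_iff_symm σ _ v).2 ⟨j, rfl⟩)
    · simp
  · congr 1
    set p : ℝ := (#B : ℝ) / Fintype.card V
    have : ∀ v, ∑ S ∈ (if v ∈ A then {∅} else univ : Finset (Finset (Fin r))),
        p ^ #S * (1 - p) ^ (r - #S) = if v ∈ A then (1 - p) ^ r else 1 := by
      intro v
      split_ifs
      · simp
      · exact sum_all_weight p
    rw [prod_congr rfl fun v _ => this v, prod_ite]
    simp

end Slices

end RandDigraph

/-! ### Deterministic facts on greedy, dominating and acyclic sets -/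

namespace RandDigraph

open Finset

section Greedy

variable {V : Type*} (ord : LinearOrder V) (D : Digraph V)

open Classical in
theorem greedyFrom_of_nonempty {W : Finset V} (h : W.Nonempty) :
    greedyFrom ord D W = insert (@Finset.min' V ord W h)
      (greedyFrom ord D
        (W.filter fun v => v ≠ @Finset.min' V ord W h ∧ ¬ D.Adj (@Finset.min' V ord W h) v)) := by
  rw [greedyFrom, dif_pos h]

theorem greedyFrom_empty : greedyFrom ord D ∅ = ∅ := by
  rw [greedyFrom, dif_neg (by simp)]

/-- A vertex chosen later has survived the deletion of out-neighbours of earlier ones, so arcs among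
chosen vertices never go forward in the order. This gives acyclicity once loops are excluded. -/
theorem greedyFrom_spec (W : Finset V) :
    greedyFrom ord D W ⊆ W ∧
    (∀ v ∈ W, v ∉ greedyFrom ord D W → ∃ u ∈ greedyFrom ord D W, D.Adj u v) ∧
    (∀ u ∈ greedyFrom ord D W, ∀ v ∈ greedyFrom ord D W, D.Adj u v → ord.le v u) := by
  classical
  induction W using Finset.strongInduction with
  | H W ih =>
    rcases W.eq_empty_or_nonempty with rfl | h
    · simp [greedyFrom_empty]
    rw [greedyFrom_of_nonempty ord D h]
    set w := @Finset.min' V ord W h with hw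
    have hwW : w ∈ W := @Finset.min'_mem V ord W h
    have hmin : ∀ v ∈ W, ord.le w v := fun v hv => @Finset.min'_le V ord W v hv
    set W' := W.filter fun v => v ≠ w ∧ ¬ D.Adj w v with hW'
    obtain ⟨h1, h2, h3⟩ := ih W' (Finset.filter_ssubset.2 ⟨w, hwW, by simp⟩)
    have hsub : W' ⊆ W := Finset.filter_subset _ _
    refine ⟨?_, ?_, ?_⟩
    · intro v hv
      rcases mem_insert.1 hv with rfl | hv
      · exact hwW
      · exact hsub (h1 hv)
    · intro v hv hv'
      rw [mem_insert, not_or] at hv'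
      by_cases hvw : D.Adj w v
      · exact ⟨w, mem_insert_self _ _, hvw⟩
      · obtain ⟨u, hu, huv⟩ := h2 v (mem_filter.2 ⟨hv, hv'.1, hvw⟩) hv'.2
        exact ⟨u, mem_insert_of_mem hu, huv⟩
    · intro u hu v hv huv
      rcases mem_insert.1 hv with rfl | hv
      · rcases mem_insert.1 hu with rfl | hu
        · exact ord.le_refl _
        · exact hmin u (hsub (h1 hu))
      · rcases mem_insert.1 hu with rfl | hu
        · exact absurd huv (mem_filter.1 (h1 hv)).2.2
        · exact h3 u hu v hv huv

variable [Fintype V]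

theorem isDominating_greedyAcyclicSet : IsDominating D (greedyAcyclicSet ord D) :=
  fun v hv => (greedyFrom_spec ord D univ).2.1 v (mem_univ v) hv

theorem isAcyclicSet_greedyAcyclicSet (hD : IsOriented D) :
    IsAcyclicSet D (greedyAcyclicSet ord D) := by
  have key : ∀ u v, Relation.TransGen (fun a b => a ∈ greedyAcyclicSet ord D ∧
      b ∈ greedyAcyclicSet ord D ∧ D.Adj a b) u v → ord.lt v u := by
    have base : ∀ a b, (a ∈ greedyAcyclicSet ord D ∧ b ∈ greedyAcyclicSet ord D ∧ D.Adj a b) →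
        ord.lt b a := by
      rintro a b ⟨ha, hb, hab⟩
      have hle := (greedyFrom_spec ord D univ).2.2 a ha b hb hab
      refine @lt_of_le_of_ne V ord.toPartialOrder b a hle ?_
      rintro rfl
      exact hD.1 _ hab
    intro u v h
    induction h with
    | single h => exact base _ _ h
    | tail _ h ih => exact @lt_trans V ord.toPreorder _ _ _ (base _ _ h) ih
  exact fun v hv => @lt_irrefl V ord.toPreorder v (key v v hv)

theorem card_greedyAcyclicSet_le_acyclicNumber (hD : IsOriented D) :
    (greedyAcyclicSet ord D).card ≤ acyclicNumber D := by
  classical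
  exact Finset.le_sup (f := Finset.card)
    (mem_filter.2 ⟨mem_univ _, isAcyclicSet_greedyAcyclicSet ord D hD⟩)

end Greedy

theorem IsDominating.mono {V : Type*} {D : Digraph V} {A B : Finset V} (h : IsDominating D A)
    (hAB : A ⊆ B) : IsDominating D B := fun v hv => by
  obtain ⟨u, hu, huv⟩ := h v fun hA => hv (hAB hA)
  exact ⟨u, hAB hu, huv⟩

/-- Each vertex covers itself and r others. For small r this count alone gives the lower bound. -/
theorem IsDominating.card_le {V : Type*} [Fintype V] {D : Digraph V} {A : Finset V} {r : ℕ}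
    (h : IsDominating D A) (hD : IsRegular r D) : Fintype.card V ≤ #A * (r + 1) := by
  classical
  have h1 : (univ : Finset V) ⊆ A ∪ A.biUnion fun u => {v | D.Adj u v} := by
    intro v _
    by_cases hv : v ∈ A
    · exact mem_union_left _ hv
    · obtain ⟨u, hu, huv⟩ := h v hv
      exact mem_union_right _ (mem_biUnion.2 ⟨u, hu, by simpa using huv⟩)
  have h2 : #(A.biUnion fun u => ({v | D.Adj u v} : Finset V)) ≤ #A * r := by
    refine card_biUnion_le_card_mul _ _ _ fun u _ => ?_
    have := (hD u).1
    rw [Set.ncard_eq_toFinset_card'] at this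
    refine le_of_eq ?_
    rw [← this]
    congr 1
    ext; simp
  have h3 := (card_le_card h1).trans (card_union_le _ _)
  rw [card_univ] at h3
  linarith

/-- An acyclic set can be built up one vertex at a time, keeping all arcs between the vertices
already present and the remaining ones directed away from the former. -/
theorem exists_initial_of_isAcyclicSet {V : Type*} {D : Digraph V} {S : Finset V}
    (hS : IsAcyclicSet D S) {k : ℕ} (hk : k ≤ #S) :
    ∃ A ⊆ S, #A = k ∧ ∀ b ∈ S, b ∉ A → ∀ a ∈ A, ¬ D.Adj b a := by
  classical
  induction k with
  | zero => exact ⟨∅, by simp⟩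
  | succ k ih =>
    obtain ⟨A, hA, hAk, hAb⟩ := ih (by omega)
    have hne : (S \ A).Nonempty := by
      rw [← card_pos, card_sdiff_of_subset hA]; omega
    -- Reachability inside S is a strict partial order; a minimal w in S \ A receives no arc from
    -- the other vertices there, so it can be appended to A.
    let R : {x // x ∈ S \ A} → {x // x ∈ S \ A} → Prop := fun x y =>
      Relation.TransGen (fun a b => a ∈ S ∧ b ∈ S ∧ D.Adj a b) x.1 y.1
    have : IsTrans _ R := ⟨fun _ _ _ h1 h2 => h1.trans h2⟩
    have : Std.Irrefl R := ⟨fun x h => hS x.1 h⟩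
    have hwf : WellFounded R := Finite.wellFounded_of_trans_of_irrefl R
    obtain ⟨w, -, hw⟩ := hwf.has_min Set.univ ⟨⟨_, hne.choose_spec⟩, trivial⟩
    have hwS := mem_sdiff.1 w.2
    refine ⟨insert w.1 A, ?_, ?_, ?_⟩
    · exact insert_subset hwS.1 hA
    · rw [card_insert_of_notMem hwS.2, hAk]
    · intro b hb hbA a ha hba
      rw [mem_insert, not_or] at hbA
      rcases mem_insert.1 ha with rfl | ha
      · exact hw ⟨b, mem_sdiff.2 ⟨hb, hbA.2⟩⟩ trivial
          (Relation.TransGen.single ⟨hb, hwS.1, hba⟩)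
      · exact hAb b hb hbA.2 a ha hba

theorem exists_noArc_of_le_acyclicNumber {V : Type*} [Fintype V] {D : Digraph V} {t : ℕ}
    (h : 2 * t ≤ acyclicNumber D) :
    ∃ A B : Finset V, #A = t ∧ #B = t ∧ ∀ b ∈ B, ∀ a ∈ A, ¬ D.Adj b a := by
  classical
  rcases Nat.eq_zero_or_pos t with rfl | ht
  · exact ⟨∅, ∅, by simp⟩
  obtain ⟨S, hS, hSt⟩ : ∃ S ∈ (univ : Finset (Finset V)).filter (IsAcyclicSet D), 2 * t ≤ #S := by
    refine (Finset.le_sup_iff (f := Finset.card) (by simpa using ht)).1 ?_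
    rw [acyclicNumber] at h
    convert h
  have hS := (mem_filter.1 hS).2
  obtain ⟨A, hA, hAt, hAb⟩ := exists_initial_of_isAcyclicSet hS (k := t) (by omega)
  obtain ⟨B, hB, hBt⟩ := exists_subset_card_eq (s := S \ A) (n := t) (by
    rw [card_sdiff_of_subset hA]; omega)
  exact ⟨A, B, hAt, hBt, fun b hb a ha => hAb b (mem_sdiff.1 (hB hb)).1 (mem_sdiff.1 (hB hb)).2 a ha⟩

end RandDigraph

/-! ### Very high probability and first moment bounds -/

namespace RandDigraph

open Finset Equiv

open Classical in
theorem prob_mono {n r : ℕ} {P Q : Digraph (Fin n) → Prop}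
    (h : ∀ D, IsOriented D → IsRegular r D → P D → Q D) : prob n r P ≤ prob n r Q := by
  refine div_le_div_of_nonneg_right (Nat.cast_le.2 (card_le_card fun D hD => ?_))
    (Nat.cast_nonneg _)
  simp only [regularOriented, mem_filter, mem_univ, true_and] at hD ⊢
  exact ⟨hD.1, h D hD.1.1 hD.1.2 hD.2⟩

theorem prob_eq_one_sub {n r : ℕ} (h : 0 < #(regularOriented n r)) (P : Digraph (Fin n) → Prop)
    [DecidablePred P] :
    prob n r P = 1 - (#((regularOriented n r).filter fun D => ¬ P D) : ℝ) /
      #(regularOriented n r) := by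
  have h1 : (#((regularOriented n r).filter P) : ℝ) +
      #((regularOriented n r).filter fun D => ¬ P D) = #(regularOriented n r) := by
    exact_mod_cast card_filter_add_card_filter_not P
  have h0 : (0 : ℝ) < #(regularOriented n r) := by exact_mod_cast h
  have e : prob n r P = (#((regularOriented n r).filter P) : ℝ) / #(regularOriented n r) := by
    rw [prob]
    congr!
  rw [e, eq_sub_iff_add_eq, ← add_div, h1, div_self h0.ne']

/-- The events `P n` hold with very high probability for random `r`-regular oriented graphs. -/
def WithVeryHighProb (r : ℕ) (P : ∀ n, Digraph (Fin n) → Prop) : Prop :=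
  ∃ c : ℝ, 0 < c ∧ ∀ᶠ n : ℕ in atTop, 1 - Real.exp (-(c * (n : ℝ))) ≤ prob n r (P n)

theorem eventually_card_le {r : ℕ} (hr : 1 ≤ r) :
    ∀ᶠ n : ℕ in atTop, 4 * (2 * r ^ 2 + 4 * r) ≤ n * r := by
  filter_upwards [eventually_ge_atTop (4 * (2 * r ^ 2 + 4 * r))] with n hn
  nlinarith

theorem eventually_poly_mul_exp_le (r M : ℕ) {δ : ℝ} (hδ : 0 < δ) :
    ∀ᶠ n : ℕ in atTop, ((n : ℝ) * r + 1) ^ M * Real.exp (-(δ * n)) ≤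
      Real.exp (-(δ / 2 * n)) := by
  have h1 : Tendsto (fun x : ℝ => x ^ M * Real.exp (-(δ / 2) * x)) atTop (nhds 0) :=
    (isLittleO_pow_exp_pos_mul_atTop M (half_pos hδ)).tendsto_div_nhds_zero.congr fun x => by
      rw [neg_mul, Real.exp_neg, div_eq_mul_inv]
  have h2 := (h1.const_mul (((r : ℝ) + 1) ^ M)).comp tendsto_natCast_atTop_atTop
  rw [mul_zero] at h2
  filter_upwards [h2.eventually (gt_mem_nhds one_pos), eventually_ge_atTop 1] with n hn hn1
  simp only [Function.comp] at hn
  have hn1' : (1 : ℝ) ≤ n := by exact_mod_cast hn1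
  have e : Real.exp (-(δ * n)) = Real.exp (-(δ / 2) * n) * Real.exp (-(δ / 2 * n)) := by
    rw [← Real.exp_add]; ring_nf
  have h3 : ((n : ℝ) * r + 1) ^ M ≤ (r + 1 : ℝ) ^ M * n ^ M := by
    rw [← mul_pow]
    exact pow_le_pow_left₀ (by positivity) (by nlinarith) _
  rw [e, ← mul_assoc]
  refine mul_le_of_le_one_left (Real.exp_nonneg _) (le_trans ?_ hn.le)
  rw [← mul_assoc]
  exact mul_le_mul_of_nonneg_right h3 (Real.exp_nonneg _)

/-- Exponentially small failure probabilities in the configuration model carry over to random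
regular oriented graphs. -/
theorem withVeryHighProb_of_config {r : ℕ} (hr : 1 ≤ r) {P : ∀ n, Digraph (Fin n) → Prop} {δ : ℝ}
    (hδ : 0 < δ)
    (h : ∀ᶠ n : ℕ in atTop, ∃ F : Finset (Perm (Fin n × Fin r)),
      (∀ σ, ¬ P n (configDigraph σ) → σ ∈ F) ∧
      (#F : ℝ) ≤ (n * r).factorial * ((n : ℝ) * r + 1) * Real.exp (-(δ * n))) :
    WithVeryHighProb r P := by
  classical
  refine ⟨δ / 2, half_pos hδ, ?_⟩
  filter_upwards [h, eventually_card_le hr,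
    eventually_poly_mul_exp_le r (4 * r ^ 2 + 10 * r + 1) hδ] with n ⟨F, hF, h1⟩ h2 h3
  have hpos := card_regularOriented_pos h2
  have hpos' : (0 : ℝ) < #(regularOriented n r) := by exact_mod_cast hpos
  rw [prob_eq_one_sub hpos, sub_le_sub_iff_left]
  refine le_trans ?_ h3
  rw [div_le_iff₀ hpos']
  have h4 : (#((regularOriented n r).filter fun D => ¬ P n D) : ℝ) * (n * r).factorial ≤
      ((n : ℝ) * r + 1) ^ (4 * r ^ 2 + 10 * r) * #(regularOriented n r) * #F := by
    exact_mod_cast card_regularOriented_filter_le h2 (fun D => ¬ P n D) hF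
  have hf : (0 : ℝ) < (n * r).factorial := by exact_mod_cast Nat.factorial_pos _
  refine le_of_mul_le_mul_right (h4.trans ?_) hf
  refine (mul_le_mul_of_nonneg_left h1 (by positivity)).trans_eq ?_
  ring

theorem WithVeryHighProb.and {r : ℕ} (hr : 1 ≤ r) {P Q : ∀ n, Digraph (Fin n) → Prop}
    (hP : WithVeryHighProb r P) (hQ : WithVeryHighProb r Q) :
    WithVeryHighProb r fun n D => P n D ∧ Q n D := by
  classical
  obtain ⟨c, hc, h1⟩ := hP
  obtain ⟨d, hd, h2⟩ := hQ
  have hm : 0 < min c d := lt_min hc hd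
  -- Halving the rate absorbs the factor 2 from adding two failure probabilities.
  have h5 : ∀ᶠ n : ℕ in atTop, Real.log 2 ≤ min c d / 2 * n :=
    (tendsto_natCast_atTop_atTop.const_mul_atTop (half_pos hm)).eventually_ge_atTop _
  refine ⟨min c d / 2, half_pos hm, ?_⟩
  filter_upwards [h1, h2, eventually_card_le hr, h5] with n h1 h2 h3 h4
  have hpos := card_regularOriented_pos h3
  have hpos' : (0 : ℝ) < #(regularOriented n r) := by exact_mod_cast hpos
  rw [prob_eq_one_sub hpos, sub_le_sub_iff_left] at h1 h2 ⊢
  have hu : (#((regularOriented n r).filter fun D => ¬ (P n D ∧ Q n D)) : ℝ) ≤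
      #((regularOriented n r).filter fun D => ¬ P n D) +
      #((regularOriented n r).filter fun D => ¬ Q n D) := by
    rw [← Nat.cast_add]
    refine Nat.cast_le.2 (le_trans (card_le_card fun D hD => ?_) (card_union_le _ _))
    simp only [mem_filter, mem_union] at hD ⊢
    tauto
  have h6 := (div_le_div_of_nonneg_right hu hpos'.le).trans_eq (add_div _ _ _)
  have hn : (0 : ℝ) ≤ n := Nat.cast_nonneg n
  have e1 : Real.exp (-(c * n)) ≤ Real.exp (-(min c d * n)) :=
    Real.exp_le_exp.2 (neg_le_neg (mul_le_mul_of_nonneg_right (min_le_left _ _) hn))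
  have e2 : Real.exp (-(d * n)) ≤ Real.exp (-(min c d * n)) :=
    Real.exp_le_exp.2 (neg_le_neg (mul_le_mul_of_nonneg_right (min_le_right _ _) hn))
  have e3 : Real.exp (-(min c d * n)) * 2 ≤ Real.exp (-(min c d / 2 * n)) := by
    conv_lhs => rw [← Real.exp_log two_pos, ← Real.exp_add]
    exact Real.exp_le_exp.2 (by linarith)
  have h7 := h6.trans (add_le_add h1 h2)
  linarith

/-- One term of the expansion of (1 + x)^n is at most e^(xn). The choice of x near k/n is the useful
one. -/
theorem choose_le_exp {n k : ℕ} {x : ℝ} (hx : 0 < x) :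
    (n.choose k : ℝ) ≤ Real.exp (x * n + k * Real.log (1 / x)) := by
  rcases lt_or_ge n k with h | h
  · rw [Nat.choose_eq_zero_of_lt h, Nat.cast_zero]; positivity
  have h1 : (n.choose k : ℝ) * x ^ k ≤ (1 + x) ^ n := by
    rw [add_comm, add_pow]
    refine le_trans ?_ (single_le_sum (f := fun j => x ^ j * 1 ^ (n - j) * (n.choose j : ℝ))
      (fun j _ => by positivity) (mem_range.2 (Nat.lt_succ_iff.2 h)))
    simp [mul_comm]
  have h2 : (1 + x) ^ n ≤ Real.exp (x * n) := by
    rw [mul_comm, Real.exp_nat_mul]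
    exact pow_le_pow_left₀ (by positivity) (by linarith [Real.add_one_le_exp x]) _
  have h3 : Real.exp (k * Real.log (1 / x)) = (x ^ k)⁻¹ := by
    rw [Real.exp_nat_mul, Real.exp_log (by positivity), one_div, inv_pow]
  rw [Real.exp_add, h3, ← div_eq_mul_inv, le_div_iff₀ (by positivity)]
  exact h1.trans h2

/-- Random regular oriented graphs have no small dominating sets. -/
theorem withVeryHighProb_isDominating {r : ℕ} (hr : 1 ≤ r) {α : ℝ} (h0 : 0 < α) (h1 : α < 1)
    (h : α * (1 + Real.log (1 / α)) < (1 - α) ^ (r + 1)) :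
    WithVeryHighProb r fun n D => ∀ A, IsDominating D A → α * n ≤ (#A : ℝ) := by
  classical
  refine withVeryHighProb_of_config hr (sub_pos.2 h) ?_
  filter_upwards [eventually_ge_atTop 1] with n hn
  have hn0 : (0 : ℝ) < n := by exact_mod_cast hn
  set s := ⌊α * n⌋₊ with hs
  have hsα : (s : ℝ) ≤ α * n := Nat.floor_le (by positivity)
  have hsn : s ≤ n := by
    have : (s : ℝ) ≤ n := by nlinarith
    exact_mod_cast this
  -- Supersets of dominating sets dominate, so only sets of size exactly s need be counted.
  refine ⟨(powersetCard s (univ : Finset (Fin n))).biUnion fun A =>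
    {σ : Perm (Fin n × Fin r) | IsDominating (configDigraph σ) A}, fun σ hσ => ?_, ?_⟩
  · push Not at hσ
    obtain ⟨A, hA, hlt⟩ := hσ
    obtain ⟨B, hAB, -, hB⟩ := exists_subsuperset_card_eq (subset_univ A)
      (Nat.le_floor hlt.le) (by simpa using hsn)
    simp only [mem_biUnion, mem_filter, mem_univ, true_and]
    exact ⟨B, mem_powersetCard.2 ⟨subset_univ _, hB⟩, hA.mono hAB⟩
  have hp : (1 - α) ≤ 1 - (s : ℝ) / n := by
    rw [sub_le_sub_iff_left, div_le_iff₀ hn0]; exact hsα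
  have hp1 : 1 - (s : ℝ) / n ≤ 1 := by
    rw [sub_le_self_iff]; positivity
  -- The bound n - s ≥ (1 - α)n supplies one more factor 1 - α, whence the exponent r + 1.
  have hpow : (1 - (1 - (s : ℝ) / n) ^ r) ^ (n - s) ≤ Real.exp (-((1 - α) ^ (r + 1) * n)) := by
    have a1 : (1 - α) ^ r ≤ (1 - (s : ℝ) / n) ^ r := pow_le_pow_left₀ (by linarith) hp _
    have a2 : 1 - (1 - (s : ℝ) / n) ^ r ≤ Real.exp (-(1 - α) ^ r) := by
      have := Real.add_one_le_exp (-(1 - α) ^ r)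
      linarith
    refine (pow_le_pow_left₀ (sub_nonneg.2 (pow_le_one₀ (by linarith) hp1)) a2 _).trans ?_
    rw [← Real.exp_nat_mul, Nat.cast_sub hsn, Real.exp_le_exp, pow_succ]
    have : 0 < (1 - α) ^ r := pow_pos (by linarith) _
    nlinarith
  have hchoose : (n.choose s : ℝ) ≤ Real.exp (α * (1 + Real.log (1 / α)) * n) := by
    refine (choose_le_exp h0).trans (Real.exp_le_exp.2 ?_)
    have hlog : 0 ≤ Real.log (1 / α) :=
      Real.log_nonneg (by rw [le_div_iff₀ h0]; linarith)
    nlinarith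
  calc _ ≤ ∑ A ∈ powersetCard s (univ : Finset (Fin n)),
        (#{σ : Perm (Fin n × Fin r) | IsDominating (configDigraph σ) A} : ℝ) := by
        exact_mod_cast card_biUnion_le
    _ ≤ ∑ A ∈ powersetCard s (univ : Finset (Fin n)), ((n * r).factorial * ((n : ℝ) * r + 1) *
        (1 - (1 - (s : ℝ) / n) ^ r) ^ (n - s)) := by
        refine sum_le_sum fun A hA => ?_
        have := card_perm_isDominating_le (r := r) hr A
        rwa [(mem_powersetCard.1 hA).2, Fintype.card_fin] at this
    _ = (n * r).factorial * ((n : ℝ) * r + 1) *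
        (n.choose s * (1 - (1 - (s : ℝ) / n) ^ r) ^ (n - s)) := by
        rw [sum_const, card_powersetCard, card_univ, Fintype.card_fin, nsmul_eq_mul]
        ring
    _ ≤ (n * r).factorial * ((n : ℝ) * r + 1) *
        (Real.exp (α * (1 + Real.log (1 / α)) * n) * Real.exp (-((1 - α) ^ (r + 1) * n))) := by
        refine mul_le_mul_of_nonneg_left (mul_le_mul hchoose hpow ?_ (Real.exp_nonneg _))
          (by positivity)
        exact pow_nonneg (sub_nonneg.2 (pow_le_one₀ (by linarith) hp1)) _
    _ = _ := by
        rw [← Real.exp_add]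
        ring_nf

/-- Random regular oriented graphs have no large acyclic sets. -/
theorem withVeryHighProb_acyclicNumber_lt {r : ℕ} (hr : 1 ≤ r) {τ : ℝ} (h0 : 0 < τ)
    (h : 2 + 2 * Real.log (1 / τ) < r * τ) :
    WithVeryHighProb r fun n D => acyclicNumber D < 2 * ⌈τ * n⌉₊ := by
  classical
  refine withVeryHighProb_of_config hr (mul_pos h0 (sub_pos.2 h)) ?_
  filter_upwards [eventually_ge_atTop 1] with n hn
  have hn0 : (0 : ℝ) < n := by exact_mod_cast hn
  set t := ⌈τ * n⌉₊ with ht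
  have hτt : τ * n ≤ t := Nat.le_ceil _
  let S := powersetCard t (univ : Finset (Fin n)) ×ˢ powersetCard t (univ : Finset (Fin n))
  refine ⟨S.biUnion fun x => {σ : Perm (Fin n × Fin r) |
    ∀ b ∈ x.2, ∀ a ∈ x.1, ¬ (configDigraph σ).Adj b a}, fun σ hσ => ?_, ?_⟩
  · obtain ⟨A, B, hA, hB, hAB⟩ := exists_noArc_of_le_acyclicNumber (not_lt.1 hσ)
    simp only [mem_biUnion, mem_filter, mem_univ, true_and]
    exact ⟨(A, B), mem_product.2 ⟨mem_powersetCard.2 ⟨subset_univ _, hA⟩,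
      mem_powersetCard.2 ⟨subset_univ _, hB⟩⟩, hAB⟩
  have hchoose : (n.choose t : ℝ) ≤ Real.exp (t * (1 + Real.log (1 / τ))) :=
    (choose_le_exp h0).trans (Real.exp_le_exp.2 (by linarith))
  calc _ ≤ ∑ x ∈ S, (#{σ : Perm (Fin n × Fin r) |
        ∀ b ∈ x.2, ∀ a ∈ x.1, ¬ (configDigraph σ).Adj b a} : ℝ) := by
        exact_mod_cast card_biUnion_le
    _ ≤ ∑ x ∈ S, ((n * r).factorial * ((n : ℝ) * r + 1) * Real.exp (-(τ * r * t))) := by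
        refine sum_le_sum fun x hx => ?_
        obtain ⟨hA, hB⟩ := mem_product.1 hx
        have := card_perm_noArc_le (r := r) hr x.1 x.2
        rw [(mem_powersetCard.1 hA).2, (mem_powersetCard.1 hB).2, Fintype.card_fin] at this
        refine this.trans (mul_le_mul_of_nonneg_left ?_ (by positivity))
        -- The pair x witnesses t ≤ n; for t > n the sum is empty.
        have htn : (t : ℝ) ≤ n := by
          have := card_le_univ x.1
          rw [(mem_powersetCard.1 hA).2, Fintype.card_fin] at this
          exact_mod_cast this
        have h1 : 1 - (t : ℝ) / n ≤ Real.exp (-τ) := by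
          have h2 : τ ≤ t / n := by rwa [le_div_iff₀ hn0]
          have := Real.add_one_le_exp (-τ)
          linarith
        have h2 : 0 ≤ 1 - (t : ℝ) / n := sub_nonneg.2 (div_le_one_of_le₀ htn hn0.le)
        rw [← pow_mul]
        refine (pow_le_pow_left₀ h2 h1 _).trans_eq ?_
        rw [← Real.exp_nat_mul]
        push_cast
        ring_nf
    _ = (n * r).factorial * ((n : ℝ) * r + 1) *
        (n.choose t * n.choose t * Real.exp (-(τ * r * t))) := by
        rw [sum_const, card_product, card_powersetCard, card_univ, Fintype.card_fin, nsmul_eq_mul]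
        push_cast
        ring
    _ ≤ (n * r).factorial * ((n : ℝ) * r + 1) *
        (Real.exp (t * (1 + Real.log (1 / τ))) * Real.exp (t * (1 + Real.log (1 / τ))) *
          Real.exp (-(τ * r * t))) := by
        gcongr
    -- The total exponent is t(2 + 2 log(1/τ) - rτ), where the bracket is negative and t ≥ τn.
    _ ≤ _ := by
        refine mul_le_mul_of_nonneg_left ?_ (by positivity)
        rw [← Real.exp_add, ← Real.exp_add, Real.exp_le_exp]
        nlinarith

end RandDigraph

/-! ### Numerical choice of the constants -/

namespace RandDigraph

open Finset

/-- A sufficient condition for the first moment bound on dominating sets to be effective. -/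
theorem domination_exponent {r : ℕ} {α κ : ℝ} (h0 : 0 < α) (h1 : α < 1)
    (h2 : 1 ≤ 2 * α * (r + 1)) (h3 : (r + 1) * α ≤ κ * Real.log (r + 1) * (1 - α))
    (h4 : α * (1.7 + Real.log (r + 1)) < Real.exp (-(κ * Real.log (r + 1)))) :
    α * (1 + Real.log (1 / α)) < (1 - α) ^ (r + 1) := by
  have hr : (0 : ℝ) < r + 1 := by positivity
  have ha : 0 < 1 - α := by linarith
  have hlog : Real.log (1 / α) ≤ 0.7 + Real.log (r + 1) := by
    have : Real.log (1 / α) ≤ Real.log (2 * (r + 1)) := by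
      refine Real.log_le_log (by positivity) ?_
      rw [div_le_iff₀ h0]; linarith
    rw [Real.log_mul two_ne_zero hr.ne'] at this
    linarith [Real.log_two_lt_d9]
  -- Together with `h3` this gives (1 - α)^(r+1) ≥ (r+1)^(-κ).
  have hexp : Real.exp (-(α / (1 - α))) ≤ 1 - α := by
    have h5 := Real.add_one_le_exp (α / (1 - α))
    have h6 : α / (1 - α) + 1 = (1 - α)⁻¹ := by field_simp; ring
    rw [Real.exp_neg]
    rw [h6] at h5
    exact inv_le_of_inv_le₀ ha h5
  calc _ ≤ α * (1.7 + Real.log (r + 1)) := by nlinarith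
    _ < _ := h4
    _ ≤ Real.exp (-(α / (1 - α))) ^ (r + 1) := by
        rw [← Real.exp_nat_mul, Real.exp_le_exp, mul_neg, neg_le_neg_iff, ← mul_div_assoc,
          div_le_iff₀ ha]
        push_cast
        exact h3
    _ ≤ _ := pow_le_pow_left₀ (Real.exp_nonneg _) hexp _

theorem domination_exponent_of_ge_exp {r : ℕ} (hr : Real.exp 48 ≤ r) {α : ℝ}
    (hα : α = 1 / 2 * Real.log (r + 1) / r) :
    0 < α ∧ α < 1 ∧ α * (1 + Real.log (1 / α)) < (1 - α) ^ (r + 1) := by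
  have hr0 : (0 : ℝ) < r := (Real.exp_pos _).trans_le hr
  set L := Real.log (r + 1) with hL
  have hL48 : 48 ≤ L := by
    rw [hL, Real.le_log_iff_exp_le (by positivity)]; linarith
  have hLe : Real.exp L = r + 1 := Real.exp_log (by positivity)
  have hq : L ^ 2 / 2 ≤ r + 1 := by
    have := Real.quadratic_le_exp_of_nonneg (show 0 ≤ L by linarith)
    linarith
  have hrL : 20 * L ≤ r := by nlinarith
  have hαr : α * r = L / 2 := by rw [hα]; field_simp
  have hα0 : 0 < α := by rw [hα]; positivity
  have hα1 : α ≤ 1 / 40 := by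
    refine le_of_mul_le_mul_right (a := (r : ℝ)) ?_ hr0
    linarith
  -- Since (r+1)α is about L/2, κ must exceed 1/2; it must stay below 1 for (r+1)^(-κ) to beat L²/r.
  refine ⟨hα0, by linarith, domination_exponent (κ := 2 / 3) hα0 (by linarith) ?_ ?_ ?_⟩
  · nlinarith
  · rw [← hL]; nlinarith
  · rw [← hL]
    -- Source of 48: the quartic term of the exponential is L^4/1944, and 48² = 2304 leaves room for
    -- L² + 1.7 L.
    have h1 : L * (1.7 + L) < Real.exp (L / 3) := by
      have := Real.pow_div_factorial_le_exp (L / 3) (by linarith) 4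
      refine lt_of_lt_of_le ?_ this
      norm_num [Nat.factorial]
      have h2 : 48 * 48 * L ^ 2 ≤ L ^ 4 := by
        have : L ^ 4 = L ^ 2 * L ^ 2 := by ring
        rw [this]
        exact mul_le_mul_of_nonneg_right (by nlinarith) (sq_nonneg L)
      nlinarith
    have h2 : Real.exp (-(2 / 3 * L)) * (r + 1) = Real.exp (L / 3) := by
      rw [← hLe, ← Real.exp_add]; ring_nf
    refine lt_of_mul_lt_mul_right (a := (r : ℝ) + 1) ?_ (by positivity)
    rw [h2]
    refine lt_of_le_of_lt ?_ h1
    have h3 : α * (r + 1) ≤ L := by nlinarith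
    nlinarith

theorem domination_exponent_of_ge {r : ℕ} (hr : 28 ≤ r) {α : ℝ}
    (hα : α = 1 / 5 * Real.logb 2 (r + 1) / r) :
    0 < α ∧ α < 1 ∧ α * (1 + Real.log (1 / α)) < (1 - α) ^ (r + 1) := by
  have hr28 : (28 : ℝ) ≤ r := by exact_mod_cast hr
  have hr0 : (0 : ℝ) < r := by linarith
  set L := Real.log (r + 1) with hL
  have hlog1 := Real.log_two_gt_d9
  have hlog2 := Real.log_two_lt_d9
  have hlog8 : Real.log 8 = 3 * Real.log 2 := by
    rw [show (8 : ℝ) = 2 ^ 3 by norm_num, Real.log_pow]; norm_num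
  have hL2 : 2 ≤ L := by
    have : Real.log 8 ≤ L := Real.log_le_log (by norm_num) (by linarith)
    linarith
  have hLr : L ≤ 0.125 * r + 1.21 := by
    -- Tangent line of the logarithm at 8.
    have h1 : L = Real.log ((r + 1) / 8) + Real.log 8 := by
      rw [Real.log_div (by positivity) (by norm_num)]; ring
    have h2 := Real.log_le_sub_one_of_pos (show (0 : ℝ) < (r + 1) / 8 by positivity)
    linarith
  have hLe : Real.exp L = r + 1 := Real.exp_log (by positivity)
  obtain ⟨c, hc⟩ : ∃ c : ℝ, c = 1 / (5 * Real.log 2) := ⟨_, rfl⟩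
  have hc1 : 0.2885 ≤ c := by
    rw [hc, le_div_iff₀ (by linarith)]; linarith
  have hc2 : c ≤ 0.2886 := by
    rw [hc, div_le_iff₀ (by linarith)]; linarith
  have hαr : α * r = c * L := by
    have : Real.log 2 ≠ 0 := by linarith
    rw [hα, hc, Real.logb, ← hL]; field_simp
  have hα0 : 0 < α := by
    refine pos_of_mul_pos_left ?_ hr0.le
    rw [hαr]; nlinarith
  have hcL1 : 0.2885 * L ≤ c * L := mul_le_mul_of_nonneg_right hc1 (by linarith)
  have hcL2 : c * L ≤ 0.2886 * L := mul_le_mul_of_nonneg_right hc2 (by linarith)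
  have hα1 : α ≤ 0.1 := by
    refine le_of_mul_le_mul_right (a := (r : ℝ)) ?_ hr0
    rw [hαr]; linarith
  have hα2 : α * (r + 1) ≤ 0.299 * L := by
    have : 28 * α ≤ α * r := by nlinarith
    linarith
  -- With κ = 1/3 and 1 - α ≥ 0.9, the condition (r+1)α ≤ κL(1 - α) follows from 0.299 ≤ 0.3.
  refine ⟨hα0, by linarith, domination_exponent (κ := 1 / 3) hα0 (by linarith) ?_ ?_ ?_⟩
  · nlinarith
  · rw [← hL]
    nlinarith
  · rw [← hL]
    have h1 : 0.299 * L * (1.7 + L) < Real.exp (2 * L / 3) := by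
      have hy : 0 ≤ 2 * L / 3 := by linarith
      have := Real.sum_le_exp_of_nonneg hy 4
      refine lt_of_lt_of_le ?_ this
      simp only [sum_range_succ, range_zero, sum_empty, Nat.factorial]
      have h2 : 2 * L ^ 2 ≤ L ^ 3 := by nlinarith [sq_nonneg L]
      norm_num
      nlinarith
    have h2 : Real.exp (-(1 / 3 * L)) * (r + 1) = Real.exp (2 * L / 3) := by
      rw [← hLe, ← Real.exp_add]; ring_nf
    refine lt_of_mul_lt_mul_right (a := (r : ℝ) + 1) ?_ (by positivity)
    rw [h2]
    refine lt_of_le_of_lt ?_ h1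
    nlinarith

/-- Equivalent to (r+1)^(r+1) ≤ 2^(5r), which fails at r = 28; from there on the probabilistic bound
takes over. -/
theorem logb_div_le_of_le {r : ℕ} (hr1 : 1 ≤ r) (hr : r ≤ 27) :
    1 / 5 * Real.logb 2 (r + 1) / r ≤ 1 / ((r : ℝ) + 1) := by
  have h : (r + 1) ^ (r + 1) ≤ 2 ^ (5 * r) := by
    interval_cases r <;> norm_num
  have h1 : ((r : ℝ) + 1) ^ (r + 1) ≤ 2 ^ (5 * r) := by exact_mod_cast h
  have h2 := Real.log_le_log (by positivity) h1
  rw [Real.log_pow, Real.log_pow] at h2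
  push_cast at h2
  have hlog : 0 < Real.log 2 := Real.log_pos (by norm_num)
  have hr0 : (0 : ℝ) < r := by exact_mod_cast hr1
  rw [div_le_div_iff₀ hr0 (by positivity), Real.logb]
  have : Real.log (r + 1) / Real.log 2 * (r + 1) ≤ 5 * r := by
    rw [div_mul_eq_mul_div, div_le_iff₀ hlog]; linarith
  linarith

theorem withVeryHighProb_dominating_ge {r : ℕ} (hr : 1 ≤ r) :
    WithVeryHighProb r fun n D => ∀ A, IsDominating D A →
      (1 / 5 : ℝ) * n * Real.logb 2 (r + 1) / r ≤ (#A : ℝ) := by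
  rcases lt_or_ge r 28 with h | h
  -- The bound is deterministic here, but `prob` vanishes when no graph exists, so the trivial event
  -- is used to supply existence.
  · obtain ⟨c, hc, hn⟩ := withVeryHighProb_of_config (P := fun _ _ => True) hr one_pos
      (.of_forall fun n => ⟨∅, by simp, by rw [card_empty, Nat.cast_zero]; positivity⟩)
    refine ⟨c, hc, hn.mono fun n hn => hn.trans (prob_mono fun D _ hD _ A hA => ?_)⟩
    have h1 := hA.card_le hD
    rw [Fintype.card_fin] at h1
    have h2 : (n : ℝ) ≤ #A * (r + 1) := by exact_mod_cast h1
    calc _ = n * (1 / 5 * Real.logb 2 (r + 1) / r) := by ring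
      _ ≤ n * (1 / ((r : ℝ) + 1)) :=
          mul_le_mul_of_nonneg_left (logb_div_le_of_le hr (by omega)) (Nat.cast_nonneg n)
      _ ≤ _ := by rwa [mul_one_div, div_le_iff₀ (by positivity)]
  · obtain ⟨h0, h1, h2⟩ := domination_exponent_of_ge h rfl
    obtain ⟨c, hc, hn⟩ := withVeryHighProb_isDominating hr h0 h1 h2
    refine ⟨c, hc, hn.mono fun n hn => hn.trans (prob_mono fun D _ hD h A hA => ?_)⟩
    refine le_trans (le_of_eq ?_) (h A hA)
    ring

/-- With τ = 8 log r / r, rτ = 8 log r exceeds 2 + 2 log r ≥ 2 + 2 log(1/τ). Two halves give 16, and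
17 absorbs the rounding. -/
theorem withVeryHighProb_acyclicNumber_le {r : ℕ} (hr : 2 ≤ r) :
    WithVeryHighProb r fun n D =>
      (acyclicNumber D : ℝ) ≤ 17 * ((n : ℝ) * Real.log r / r) := by
  have hr2 : (2 : ℝ) ≤ r := by exact_mod_cast hr
  have hr0 : (0 : ℝ) < r := by linarith
  set L := Real.log r with hL
  have hL2 : 0.69 ≤ L := by
    have := Real.log_le_log two_pos hr2
    linarith [Real.log_two_gt_d9]
  have hτ : 0 < 8 * L / r := by positivity
  have hlog : Real.log (1 / (8 * L / r)) ≤ L := by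
    refine Real.log_le_log (by positivity) ?_
    rw [one_div_div, div_le_iff₀ (by positivity)]
    nlinarith
  have hmul : r * (8 * L / r) = 8 * L := by field_simp
  obtain ⟨c, hc, hn⟩ := withVeryHighProb_acyclicNumber_lt (by omega : 1 ≤ r) hτ
    (by rw [hmul]; linarith)
  have hev : ∀ᶠ n : ℕ in atTop, 2 ≤ L / r * (n : ℝ) :=
    (tendsto_natCast_atTop_atTop.const_mul_atTop (by positivity)).eventually_ge_atTop _
  refine ⟨c, hc, ?_⟩
  filter_upwards [hn, hev] with n hn hev
  refine hn.trans (prob_mono fun D _ _ h => ?_)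
  have h1 : (acyclicNumber D : ℝ) ≤ 2 * ⌈8 * L / r * n⌉₊ := by exact_mod_cast h.le
  have h2 := Nat.ceil_lt_add_one (show 0 ≤ 8 * L / r * n by positivity)
  have e1 : 8 * L / r * n = 8 * (L / r * n) := by ring
  have e2 : n * L / r = L / r * n := by ring
  rw [e2]
  linarith

end RandDigraph

/-! ### The theorem -/

theorem theorem4p3 :
    (∀ r : ℕ, 1 ≤ r →
      ∃ c : ℝ, 0 < c ∧ ∀ᶠ n : ℕ in atTop, ∀ ord : LinearOrder (Fin n),
        1 - Real.exp (-(c * (n : ℝ))) ≤ RandDigraph.prob n r (fun D =>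
          (1 / 5 : ℝ) * (n : ℝ) * Real.logb 2 ((r : ℝ) + 1) / (r : ℝ) ≤
            ((RandDigraph.greedyAcyclicSet ord D).card : ℝ))) ∧
    (∀ ε : ℝ, 0 < ε → ∃ rε : ℕ, 1 ≤ rε ∧ ∀ r : ℕ, rε ≤ r →
      ∃ c : ℝ, 0 < c ∧ ∀ᶠ n : ℕ in atTop, ∀ ord : LinearOrder (Fin n),
        1 - Real.exp (-(c * (n : ℝ))) ≤ RandDigraph.prob n r (fun D =>
          (1 / 2 - ε : ℝ) * (n : ℝ) * Real.log ((r : ℝ) + 1) / (r : ℝ) ≤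
            ((RandDigraph.greedyAcyclicSet ord D).card : ℝ))) ∧
    (∃ a b : ℝ, 0 < a ∧ 0 < b ∧ ∀ r : ℕ, 2 ≤ r →
      ∃ c : ℝ, 0 < c ∧ ∀ᶠ n : ℕ in atTop,
        1 - Real.exp (-(c * (n : ℝ))) ≤ RandDigraph.prob n r (fun D =>
          a * ((n : ℝ) * Real.log (r : ℝ) / (r : ℝ)) ≤ (RandDigraph.acyclicNumber D : ℝ) ∧
            (RandDigraph.acyclicNumber D : ℝ) ≤ b * ((n : ℝ) * Real.log (r : ℝ) / (r : ℝ)))) := by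
  -- The threshold e^48 serves every ε, since from there on the constant 1/2 itself is reached.
  refine ⟨fun r hr => ?_, fun ε hε => ⟨⌈Real.exp 48⌉₊, ?_, fun r hr => ?_⟩,
    1 / 5, 17, by norm_num, by norm_num, fun r hr => ?_⟩
  · obtain ⟨c, hc, hn⟩ := RandDigraph.withVeryHighProb_dominating_ge hr
    exact ⟨c, hc, hn.mono fun n hn ord => hn.trans (RandDigraph.prob_mono fun D _ _ h =>
      h _ (RandDigraph.isDominating_greedyAcyclicSet ord D))⟩
  · exact Nat.one_le_ceil_iff.2 (Real.exp_pos _)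
  · have hr' : Real.exp 48 ≤ r := Nat.ceil_le.1 hr
    have hr1 : 1 ≤ r := (Nat.one_le_ceil_iff.2 (Real.exp_pos _)).trans hr
    obtain ⟨h0, h1, h2⟩ := RandDigraph.domination_exponent_of_ge_exp hr' rfl
    obtain ⟨c, hc, hn⟩ := RandDigraph.withVeryHighProb_isDominating hr1 h0 h1 h2
    refine ⟨c, hc, hn.mono fun n hn ord => hn.trans (RandDigraph.prob_mono fun D _ _ h => ?_)⟩
    refine le_trans ?_ (h _ (RandDigraph.isDominating_greedyAcyclicSet ord D))
    have hlog : 0 ≤ (n : ℝ) * Real.log ((r : ℝ) + 1) / r := by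
      have := Real.log_nonneg (show (1 : ℝ) ≤ (r : ℝ) + 1 by simp)
      positivity
    calc (1 / 2 - ε : ℝ) * n * Real.log ((r : ℝ) + 1) / r
        = (1 / 2 - ε) * (n * Real.log ((r : ℝ) + 1) / r) := by ring
      _ ≤ 1 / 2 * (n * Real.log ((r : ℝ) + 1) / r) :=
          mul_le_mul_of_nonneg_right (by linarith) hlog
      _ = _ := by ring
  · have hr0 : (0 : ℝ) < r := by exact_mod_cast (by omega : 0 < r)
    obtain ⟨c, hc, hn⟩ := (RandDigraph.withVeryHighProb_dominating_ge (by omega : 1 ≤ r)).and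
      (by omega) (RandDigraph.withVeryHighProb_acyclicNumber_le hr)
    refine ⟨c, hc, hn.mono fun n hn => hn.trans (RandDigraph.prob_mono fun D hD _ h => ⟨?_, h.2⟩)⟩
    have h1 := h.1 _ (RandDigraph.isDominating_greedyAcyclicSet inferInstance D)
    have h2 : ((RandDigraph.greedyAcyclicSet inferInstance D).card : ℝ) ≤
        RandDigraph.acyclicNumber D := by
      exact_mod_cast RandDigraph.card_greedyAcyclicSet_le_acyclicNumber inferInstance D hD
    refine le_trans ?_ (h1.trans h2)
    have hlog2 : Real.log 2 ≤ 1 := by linarith [Real.log_two_lt_d9]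
    have hlog : Real.log r ≤ Real.logb 2 (r + 1) := by
      rw [Real.logb, le_div_iff₀ (Real.log_pos (by norm_num))]
      have h3 : Real.log r ≤ Real.log (r + 1) := Real.log_le_log hr0 (by linarith)
      have h4 : 0 ≤ Real.log r := Real.log_natCast_nonneg r
      nlinarith
    calc 1 / 5 * ((n : ℝ) * Real.log r / r) = n / (5 * r) * Real.log r := by ring
      _ ≤ n / (5 * r) * Real.logb 2 (r + 1) := mul_le_mul_of_nonneg_left hlog (by positivity)
      _ = _ := by ring
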